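/- Let $n\ge 3$ and let $D\subset\mathbb C^n$ be an open set that is not pseudoconvex. Let $S$ be the union of all $2$-dimensional complex affine planes $P\subset\mathbb C^n$ such that $P\cap D$ is non-empty and not pseudoconvex (as an open subset of $P\cong\mathbb C^2$). Thus $\mathbb C^n\setminus S$ is the set of exceptional points with respect to $D$, i.e. of those $a\in\mathbb C^n$ such that $P\cap D$ is pseudoconvex for every $2$-dimensional complex affine plane $P$ containing $a$. Suppose that there is a boundary point $p\in\partial D$ such that $D$ is $C^2$-smooth near $p$ (that is, there are an open neighbourhood $U$ of $p$ and a $C^2$ function $r:U\to\mathbb R$ with nowhere vanishing differential such that $D\cap U=\{z\in U: r(z)<0\}$) and $D$ is non-pseudoconvex near $p$ (that is, $D\cap V$ is not pseudoconvex for any open neighbourhood $V$ of $p$). Then there exists a complex affine plane $T\subset\mathbb C^n$ of codimension $3$ such that $\mathbb C^n\setminus S\subset T$. Here an open set is called pseudoconvex if it admits a continuous plurisubharmonic exhaustion function; the empty set is pseudoconvex. -/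

import Mathlib

open Set

/-- A real-valued function `u` which is continuous on `A` is plurisubharmonic on `A`: it satisfies
the sub-mean value inequality on every closed affine complex disc `{z + ζ X : |ζ| ≤ 1}` contained
in `A`. It is used for sets `A` that are open in `E`, or relatively open in a complex affine
subspace `P` of `E`; in the second case the discs contained in `A` are those of `P`, so that this
is plurisubharmonicity on `A` regarded as an open subset of `P`. -/
def ContPlurisubharmonicOn {E : Type*} [NormedAddCommGroup E] [NormedSpace ℂ E]
    (u : E → ℝ) (A : Set E) : Prop :=
  ContinuousOn u A ∧
    ∀ z X : E, (∀ ζ : ℂ, ‖ζ‖ ≤ 1 → z + ζ • X ∈ A) →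
      u z ≤ Real.circleAverage (fun ζ : ℂ => u (z + ζ • X)) 0 1

/-- Pseudoconvexity: `A` has a continuous plurisubharmonic exhaustion function, that is, one whose
sublevel sets are compact subsets of `A`. It is used for sets `A` that are open in `E`, or
relatively open in a complex affine subspace `P` of `E`; in the second case every ingredient
(continuity, discs in `A`, compactness) is intrinsic to `P`, so that this is pseudoconvexity of `A`
regarded as an open subset of `P`. -/
def IsPseudoconvex {E : Type*} [NormedAddCommGroup E] [NormedSpace ℂ E] (A : Set E) : Prop :=
  ∃ u : E → ℝ, ContPlurisubharmonicOn u A ∧ ∀ c : ℝ, IsCompact {z | z ∈ A ∧ u z ≤ c}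

/-- `D` is not pseudoconvex near `p`: no open neighbourhood of `p` has pseudoconvex intersection
with `D`. -/
def NonPseudoconvexNear {E : Type*} [NormedAddCommGroup E] [NormedSpace ℂ E]
    (D : Set E) (p : E) : Prop :=
  ∀ U : Set E, IsOpen U → p ∈ U → ¬ IsPseudoconvex (D ∩ U)

/-- `D` is `C²`-smooth near `p`: it is given near `p` by a `C²` defining function with nowhere
vanishing (real) differential. -/
def IsC2SmoothNear {n : ℕ} (D : Set (EuclideanSpace ℂ (Fin n)))
    (p : EuclideanSpace ℂ (Fin n)) : Prop :=
  ∃ (U : Set (EuclideanSpace ℂ (Fin n))) (r : EuclideanSpace ℂ (Fin n) → ℝ),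
    IsOpen U ∧ p ∈ U ∧ ContDiffOn ℝ 2 r U ∧ (∀ z ∈ U, fderiv ℝ r z ≠ 0) ∧
      D ∩ U = {z | z ∈ U ∧ r z < 0}

/-- The union of all complex affine planes of dimension 2 whose intersection with `D` is non-empty
and not pseudoconvex. The exceptional points with respect to `D` are the points of its
complement, see `mem_compl_nonPseudoconvexPlanes`. -/
def nonPseudoconvexPlanes {n : ℕ} (D : Set (EuclideanSpace ℂ (Fin n))) :
    Set (EuclideanSpace ℂ (Fin n)) :=
  {a | ∃ P : AffineSubspace ℂ (EuclideanSpace ℂ (Fin n)),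
    a ∈ P ∧ Module.finrank ℂ P.direction = 2 ∧
      ((P : Set (EuclideanSpace ℂ (Fin n))) ∩ D).Nonempty ∧
      ¬ IsPseudoconvex ((P : Set (EuclideanSpace ℂ (Fin n))) ∩ D)}

theorem isPseudoconvex_empty {E : Type*} [NormedAddCommGroup E] [NormedSpace ℂ E] :
    IsPseudoconvex (∅ : Set E) :=
  ⟨fun _ => 0, ⟨continuousOn_empty _, fun _ _ h => (h 0 (by simp)).elim⟩, fun c => by simp⟩

/-- A point lies in the complement of `nonPseudoconvexPlanes D` if and only if every complex affine
plane of dimension 2 through it has pseudoconvex intersection with `D`. -/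
theorem mem_compl_nonPseudoconvexPlanes {n : ℕ} (D : Set (EuclideanSpace ℂ (Fin n)))
    (a : EuclideanSpace ℂ (Fin n)) :
    a ∈ (nonPseudoconvexPlanes D)ᶜ ↔
      ∀ P : AffineSubspace ℂ (EuclideanSpace ℂ (Fin n)),
        a ∈ P → Module.finrank ℂ P.direction = 2 →
          IsPseudoconvex ((P : Set (EuclideanSpace ℂ (Fin n))) ∩ D) := by
  constructor
  · intro h P ha hP
    by_contra hc
    refine h ⟨P, ha, hP, ?_, hc⟩
    by_contra he
    rw [Set.not_nonempty_iff_eq_empty] at he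
    exact hc (he ▸ isPseudoconvex_empty)
  · rintro h ⟨P, ha, hP, -, hc⟩
    exact hc (h P ha hP)

/-!
Let `r` be the `C²` defining function of `D` near the given boundary point. Call a boundary point
`q` negative if the Levi form of `r` at `q` is negative in some complex tangent direction.

*Negative points exist near the given point.* Otherwise `-log δ`, with `δ` the distance to the
complement of `D`, would be plurisubharmonic near it, and its maximum with the exhaustion function
of a ball would show `D` to be pseudoconvex there. Indeed, if `-log δ` violates the sub-mean value
inequality on a disc, it is touched from above by the real part of a holomorphic function minus
`ε |τ|²` (`exists_touching_of_circleAverage_lt`). Adding to the disc a holomorphic multiple of the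
vector to the nearest boundary point gives a holomorphic curve that touches the boundary from
inside with quadratic separation, so that the nearest boundary point is negative
(`exists_leviNegativeAlong_of_le_infDist`). No regularity of `δ` is needed.

*Planes through a negative point.* Let `X` be a negative direction at `q`, and let the plane through
`q` spanned by `X` and `Y` be transversal to the boundary. In this plane, discs on parabolas tangent
to `X` lie in `D` and converge to a disc that meets the complement only at `q`. The maximum
principle on such parabolas (`ContPlurisubharmonicOn.le_of_le_on_boundary_of_parabola`) bounds any
exhaustion function on the discs by its values near their boundaries, which is impossible
(`not_isPseudoconvex_of_leviNegativeAlong`). With `Y = a - q`, this shows that an exceptional point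
`a` satisfies `∂r(q)(a - q) = 0` at every negative point `q`.

*Counting dimensions.* Negativity is an open condition, so the last identity can be differentiated
along the boundary. By Lagrange multipliers, `a - q` lies in a subspace `N_q` (`hessianKernel`) of
the complex tangent space `T_q`. The Levi form vanishes on `N_q` but not on `T_q`, so that `N_q` has
codimension at least two. The boundary is not contained in `q + T_q` near `q`, so there is a
negative point `q'` outside `q + T_q`. All exceptional points lie in `(q' + N_{q'}) ∩ (q + T_q)`,
and if this is not empty, its direction is a proper subspace of `N_{q'}`.
-/

open Filter Topology Asymptotics

/-! ### Harmonic comparison on the unit disc -/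

theorem Differentiable.circleAverage_re {f : ℂ → ℂ} (hf : Differentiable ℂ f) (c : ℂ) (R : ℝ) :
    Real.circleAverage (fun ζ => (f ζ).re) c R = (f c).re := by
  have h := Complex.reCLM.circleAverage_comp_comm (f := f) (c := c) (R := R)
    (hf.continuous.continuousOn.circleIntegrable')
  rw [hf.diffContOnCl.circleAverage] at h
  exact h

theorem exists_differentiable_re_approx_of_continuousOn_sphere {v : ℂ → ℝ}
    (hv : ContinuousOn v (Metric.sphere 0 1)) {η : ℝ} (hη : 0 < η) :
    ∃ f : ℂ → ℂ, Differentiable ℂ f ∧ ∀ ζ ∈ Metric.sphere (0 : ℂ) 1, |v ζ - (f ζ).re| < η := by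
  have : Fact ((0 : ℝ) < 1) := ⟨one_pos⟩
  let G : C(AddCircle (1 : ℝ), ℂ) :=
    ⟨fun x => ((v (AddCircle.toCircle x) : ℝ) : ℂ), by
      refine Complex.continuous_ofReal.comp (hv.comp_continuous ?_
        fun x => by simp [Circle.norm_coe])
      exact continuous_subtype_val.comp AddCircle.continuous_toCircle⟩
  have hG : G ∈ (Submodule.span ℂ (range <| @fourier (1 : ℝ))).topologicalClosure := by
    rw [span_fourier_closure_eq_top]; trivial
  obtain ⟨g, hg, hgG⟩ := Metric.mem_closure_iff.1 hG η hη
  -- Every trigonometric polynomial is the sum of a holomorphic and an antiholomorphic polynomial.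
  have key : ∃ f₁ f₂ : ℂ → ℂ, Differentiable ℂ f₁ ∧ Differentiable ℂ f₂ ∧
      ∀ x, g x = f₁ (AddCircle.toCircle x) + (starRingEnd ℂ) (f₂ (AddCircle.toCircle x)) := by
    clear hgG
    induction hg using Submodule.span_induction with
    | mem y hy =>
      obtain ⟨n, rfl⟩ := hy
      obtain ⟨m, rfl | rfl⟩ := n.eq_nat_or_neg
      · refine ⟨fun ζ => ζ ^ m, 0, by fun_prop, by fun_prop, fun x => ?_⟩
        simp [fourier_apply, AddCircle.toCircle_nsmul]
      · refine ⟨0, fun ζ => ζ ^ m, by fun_prop, by fun_prop, fun x => ?_⟩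
        rw [fourier_neg]
        simp [fourier_apply, AddCircle.toCircle_nsmul]
    | zero => exact ⟨0, 0, by fun_prop, by fun_prop, fun x => by simp⟩
    | add y z _ _ hy hz =>
      obtain ⟨f₁, f₂, h₁, h₂, h⟩ := hy
      obtain ⟨f₃, f₄, h₃, h₄, h'⟩ := hz
      refine ⟨f₁ + f₃, f₂ + f₄, h₁.add h₃, h₂.add h₄, fun x => ?_⟩
      simp only [ContinuousMap.add_apply, h, h', Pi.add_apply, map_add]
      ring
    | smul c y _ hy =>
      obtain ⟨f₁, f₂, h₁, h₂, h⟩ := hy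
      refine ⟨fun ζ => c * f₁ ζ, fun ζ => (starRingEnd ℂ) c * f₂ ζ, h₁.const_mul _,
        h₂.const_mul _, fun x => ?_⟩
      simp [h, mul_add]
  obtain ⟨f₁, f₂, h₁, h₂, h⟩ := key
  refine ⟨fun ζ => f₁ ζ + f₂ ζ, h₁.add h₂, fun ζ hζ => ?_⟩
  obtain ⟨w, rfl⟩ : ∃ w : Circle, (w : ℂ) = ζ := ⟨⟨ζ, hζ⟩, rfl⟩
  obtain ⟨x, hx⟩ := (AddCircle.homeomorphCircle (one_ne_zero (α := ℝ))).surjective w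
  rw [AddCircle.homeomorphCircle_apply] at hx
  have h3 := (ContinuousMap.dist_apply_le_dist (f := G) (g := g) x).trans_lt hgG
  have h4 : ((AddCircle.toCircle x : Circle) : ℂ) = w := by rw [hx]
  rw [Complex.dist_eq, h] at h3
  refine lt_of_le_of_lt ?_ h3
  refine le_trans (le_of_eq ?_) (Complex.abs_re_le_norm _)
  simp [G, h4]

/-- A continuous function that violates the sub-mean value inequality on the unit disc is touched
from above, at an interior point, by a strictly superharmonic function of the form
`v ζ₀ + Re g - ε |τ|²` with `g` entire. -/
theorem exists_touching_of_circleAverage_lt {v : ℂ → ℝ}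
    (hv : ContinuousOn v (Metric.closedBall 0 1)) (h : Real.circleAverage v 0 1 < v 0) :
    ∃ ζ₀ ∈ Metric.ball (0 : ℂ) 1, ∃ ε > 0, ∃ g : ℂ → ℂ, Differentiable ℂ g ∧ g 0 = 0 ∧
      ∀ τ, ζ₀ + τ ∈ Metric.closedBall (0 : ℂ) 1 →
        v (ζ₀ + τ) ≤ v ζ₀ + (g τ).re - ε * ‖τ‖ ^ 2 := by
  obtain ⟨η, hη, hgap⟩ : ∃ η > 0, Real.circleAverage v 0 1 + 4 * η = v 0 :=
    ⟨(v 0 - Real.circleAverage v 0 1) / 4, by linarith, by ring⟩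
  have hvs : ContinuousOn v (Metric.sphere 0 1) := hv.mono Metric.sphere_subset_closedBall
  obtain ⟨f, hf, hfv⟩ := exists_differentiable_re_approx_of_continuousOn_sphere hvs hη
  have hre : Continuous fun ζ => (f ζ).re := Complex.continuous_re.comp hf.continuous
  have hf0 : (f 0).re ≤ Real.circleAverage v 0 1 + η := by
    rw [← hf.circleAverage_re 0 1, ← Real.circleAverage_const η 0 1,
      ← Real.circleAverage_fun_add (hvs.circleIntegrable zero_le_one)
        (circleIntegrable_const _ _ _)]
    refine Real.circleAverage_mono hre.continuousOn.circleIntegrable'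
      ((hvs.add continuousOn_const).circleIntegrable zero_le_one) fun ζ hζ => ?_
    rw [abs_one] at hζ
    have := abs_lt.1 (hfv ζ hζ)
    linarith
  obtain ⟨ζ₀, hζ₀, hmax⟩ := (isCompact_closedBall (0 : ℂ) 1).exists_isMaxOn
    ⟨0, by simp⟩ (f := fun ζ => v ζ - (f ζ).re + η * ‖ζ‖ ^ 2)
    ((hv.sub hre.continuousOn).add (by fun_prop))
  have hζ₀' : ζ₀ ∈ Metric.ball (0 : ℂ) 1 := by
    rw [mem_ball_zero_iff]
    refine lt_of_le_of_ne (mem_closedBall_zero_iff.1 hζ₀) fun hc => ?_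
    have h1 := hmax (show (0 : ℂ) ∈ Metric.closedBall 0 1 by simp)
    have h2 := abs_lt.1 (hfv ζ₀ (by simpa using hc))
    simp only [mem_ofPred_eq, norm_zero, hc] at h1
    norm_num at h1
    linarith
  refine ⟨ζ₀, hζ₀', η, hη, fun τ => f (ζ₀ + τ) - f ζ₀ - 2 * η * (starRingEnd ℂ) ζ₀ * τ,
    by fun_prop, by simp, fun τ hτ => ?_⟩
  have h1 := hmax hτ
  have h2 : ‖ζ₀ + τ‖ ^ 2 = ‖ζ₀‖ ^ 2 + 2 * ((starRingEnd ℂ) ζ₀ * τ).re + ‖τ‖ ^ 2 := by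
    simp only [← Complex.normSq_eq_norm_sq, Complex.normSq_apply, Complex.add_re, Complex.add_im,
      Complex.mul_re, Complex.conj_re, Complex.conj_im]
    ring
  have h3 : (2 * (η : ℂ) * (starRingEnd ℂ) ζ₀ * τ).re = 2 * η * ((starRingEnd ℂ) ζ₀ * τ).re := by
    rw [mul_assoc, show (2 * (η : ℂ)) = ((2 * η : ℝ) : ℂ) by push_cast; ring,
      Complex.re_ofReal_mul]
  simp only [mem_ofPred_eq, h2] at h1
  simp only [Complex.sub_re, h3]
  nlinarith

/-! ### Second order expansions and hypersurfaces in real normed spaces -/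

/-- Second order Taylor expansion of a `C²` function with Peano remainder. -/
theorem ContDiffAt.isLittleO_taylor_two {E : Type*} [NormedAddCommGroup E] [NormedSpace ℝ E]
    {r : E → ℝ} {q : E} (hr : ContDiffAt ℝ 2 r q) :
    (fun h => r (q + h) - r q - fderiv ℝ r q h - 1 / 2 * fderiv ℝ (fderiv ℝ r) q h h)
      =o[𝓝 0] fun h => ‖h‖ ^ 2 := by
  set H := fderiv ℝ (fderiv ℝ r) q with hHdef
  have hsymm : ∀ v w, H v w = H w v := fun v w =>
    (hr.isSymmSndFDerivAt (by simp)).eq v w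
  have hH : HasFDerivAt (fderiv ℝ r) H q :=
    ((hr.fderiv_right (m := 1) (by norm_num)).differentiableAt (by norm_num)).hasFDerivAt
  have hd : ∀ᶠ h in 𝓝 (0 : E), DifferentiableAt ℝ r (q + h) := by
    have h1 : ∀ᶠ z in 𝓝 q, DifferentiableAt ℝ r z :=
      (hr.eventually (by simp)).mono fun z hz => hz.differentiableAt (by norm_num)
    have h2 : Tendsto (fun h => q + h) (𝓝 0) (𝓝 q) := by
      simpa using (continuous_const_add q).tendsto 0
    exact h2.eventually h1
  rw [isLittleO_iff]
  intro ε hε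
  have h3 := (hasFDerivAt_iff_isLittleO_nhds_zero.1 hH).def hε
  obtain ⟨ρ, hρ, hb⟩ := Metric.eventually_nhds_iff_ball.1 (hd.and h3)
  filter_upwards [Metric.ball_mem_nhds (0 : E) hρ] with h hh
  rw [mem_ball_zero_iff] at hh
  let g : E → ℝ := fun h => r (q + h) - r q - fderiv ℝ r q h - 1 / 2 * H h h
  have hg : ∀ x ∈ Metric.closedBall (0 : E) ‖h‖,
      HasFDerivWithinAt g (fderiv ℝ r (q + x) - fderiv ℝ r q - H x)
        (Metric.closedBall (0 : E) ‖h‖) x := by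
    intro x hx
    rw [mem_closedBall_zero_iff] at hx
    have h4 := (hb x (by rw [mem_ball_zero_iff]; linarith)).1.hasFDerivAt
    have h5 : HasFDerivAt (fun x => r (q + x)) (fderiv ℝ r (q + x)) x := by
      exact (h4.comp x ((hasFDerivAt_id x).const_add q)).congr_fderiv (by ext; simp)
    have h6 : HasFDerivAt (fun x => H x x) (H.flip x + H x) x := by
      have := H.hasFDerivAt.clm_apply (hasFDerivAt_id x)
      refine (this.congr_fderiv ?_)
      ext v
      simp [add_comm]
    have h7 := ((h5.sub_const (r q)).sub (fderiv ℝ r q).hasFDerivAt).sub (h6.const_mul (1 / 2))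
    refine (h7.congr_fderiv ?_).hasFDerivWithinAt
    ext v
    simp [hsymm v x]
    ring
  have h8 := (convex_closedBall (0 : E) ‖h‖).norm_image_sub_le_of_norm_hasFDerivWithin_le
    (C := ε * ‖h‖) hg (fun x hx => ?_) (x := 0) (y := h) (by simp) (by simp)
  · have h9 : g 0 = 0 := by simp [g]
    rw [h9, sub_zero, sub_zero] at h8
    rw [norm_pow, norm_norm, pow_two, ← mul_assoc]
    exact h8
  · rw [mem_closedBall_zero_iff] at hx
    refine ((hb x (by rw [mem_ball_zero_iff]; linarith)).2).trans ?_
    gcongr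

/-- Uniform monotonicity of a strictly differentiable function in a direction `v` in which its
derivative exceeds `a`. -/
theorem HasStrictFDerivAt.eventually_add_mul_le {E : Type*} [NormedAddCommGroup E]
    [NormedSpace ℝ E] {r : E → ℝ} {r' : E →L[ℝ] ℝ} {q v : E} {a : ℝ}
    (hr : HasStrictFDerivAt r r' q) (ha : a < r' v) :
    ∀ᶠ p : E × ℝ in 𝓝 (q, 0), 0 ≤ p.2 → r p.1 + a * p.2 ≤ r (p.1 + p.2 • v) := by
  have hκ : 0 < (r' v - a) / (‖v‖ + 1) := div_pos (by linarith) (by positivity)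
  have ht : Tendsto (fun p : E × ℝ => (p.1 + p.2 • v, p.1)) (𝓝 (q, 0)) (𝓝 (q, q)) := by
    have : Continuous fun p : E × ℝ => (p.1 + p.2 • v, p.1) := by fun_prop
    simpa using this.tendsto (q, 0)
  filter_upwards [ht.eventually (hr.isLittleO.def hκ)] with p hp hp0
  simp only [add_sub_cancel_left, map_smul, smul_eq_mul, norm_smul, Real.norm_eq_abs,
    abs_of_nonneg hp0] at hp
  have h1 := (abs_le.1 hp).1
  have h2 : (r' v - a) / (‖v‖ + 1) * (p.2 * ‖v‖) ≤ (r' v - a) * p.2 := by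
    rw [div_mul_eq_mul_div, div_le_iff₀ (by positivity)]
    nlinarith [mul_nonneg (sub_nonneg.2 ha.le) hp0]
  linarith

/-- A function vanishing on a hypersurface has a differential vanishing on its tangent space. -/
theorem HasStrictFDerivAt.apply_eq_zero_of_eventually_eq_zero {E : Type*} [NormedAddCommGroup E]
    [NormedSpace ℝ E] [CompleteSpace E] {r φ : E → ℝ} {r' φ' : StrongDual ℝ E} {q : E}
    (hr : HasStrictFDerivAt r r' q) (hφ : HasStrictFDerivAt φ φ' q) (hr' : r' ≠ 0)
    (h : ∀ᶠ z in 𝓝 q, r z = r q → φ z = 0) {v : E} (hv : r' v = 0) : φ' v = 0 := by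
  have hmax : IsLocalMaxOn φ {z | r z = r q} q := by
    filter_upwards [nhdsWithin_le_nhds h, self_mem_nhdsWithin] with z hz hzr
    rw [hz hzr, h.self_of_nhds rfl]
  obtain ⟨a, b, hab, hsum⟩ := IsLocalExtrOn.exists_multipliers_of_hasStrictFDerivAt_1d
    (Or.inr hmax) hr hφ
  have hb : b ≠ 0 := by
    rintro rfl
    rw [zero_smul, add_zero] at hsum
    rcases smul_eq_zero.1 hsum with rfl | h'
    · exact hab rfl
    · exact hr' h'
  have h1 := congrArg (fun f : StrongDual ℝ E => f v) hsum
  simpa [hv, hb] using h1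

/-- Second order Taylor expansion of an entire function at the origin. -/
theorem Differentiable.exists_isLittleO_quadratic {k : ℂ → ℂ} (hk : Differentiable ℂ k) :
    ∃ a b : ℂ, (fun τ => k τ - (k 0 + a * τ + b * τ ^ 2)) =o[𝓝 0] fun τ => ‖τ‖ ^ 2 := by
  obtain ⟨p, hp⟩ := hk.analyticAt 0
  have h := hp.isBigO_sub_partialSum_pow 3
  have h2 : (fun τ : ℂ => ‖τ‖ ^ 3) =o[𝓝 0] fun τ => ‖τ‖ ^ 2 :=
    (isLittleO_pow_pow (𝕜 := ℝ) (by norm_num : 2 < 3)).comp_tendsto (tendsto_norm_zero (E := ℂ))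
  refine ⟨p.coeff 1, p.coeff 2, (h.trans_isLittleO h2).congr_left fun τ => ?_⟩
  have h0 : p.coeff 0 = k 0 := hp.coeff_zero _
  simp only [zero_add, FormalMultilinearSeries.partialSum, Finset.sum_range_succ,
    Finset.sum_range_zero, FormalMultilinearSeries.apply_eq_prod_smul_coeff, h0]
  simp
  ring

variable {E : Type*} [NormedAddCommGroup E] [NormedSpace ℂ E]

/-! ### The Levi form and the complex tangent space -/

/-- The Levi form of `r` at `z` is negative in the direction `X`, and `X` is tangent to the level
set of `r` as a complex direction. Up to the factor `1/4`, the Levi form in the direction `X` is the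
sum of the values of the real Hessian of `r` at `X` and `I • X`. -/
def LeviNegativeAlong (r : E → ℝ) (z X : E) : Prop :=
  fderiv ℝ r z X = 0 ∧ fderiv ℝ r z (Complex.I • X) = 0 ∧
    fderiv ℝ (fderiv ℝ r) z X X +
      fderiv ℝ (fderiv ℝ r) z (Complex.I • X) (Complex.I • X) < 0

/-- The complex-linear functional whose real part is the real differential of `r` at `z`, that is,
`2 ∂r`. Its kernel is the complex tangent space of the level set of `r`. -/
noncomputable def complexGradient (r : E → ℝ) (z : E) : StrongDual ℂ E :=
  StrongDual.extendRCLike (fderiv ℝ r z)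

theorem re_complexGradient_apply (r : E → ℝ) (z v : E) :
    (complexGradient r z v).re = fderiv ℝ r z v :=
  StrongDual.re_extendRCLike_apply (𝕜 := ℂ) _ v

theorem im_complexGradient_apply (r : E → ℝ) (z v : E) :
    (complexGradient r z v).im = -fderiv ℝ r z (Complex.I • v) :=
  StrongDual.im_extendRCLike_apply (𝕜 := ℂ) _ v

theorem complexGradient_apply_eq_zero_iff {r : E → ℝ} {z v : E} :
    complexGradient r z v = 0 ↔ fderiv ℝ r z v = 0 ∧ fderiv ℝ r z (Complex.I • v) = 0 := by
  rw [Complex.ext_iff, re_complexGradient_apply, im_complexGradient_apply, Complex.zero_re,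
    Complex.zero_im, neg_eq_zero]

theorem exists_complexGradient_apply_ne_zero {r : E → ℝ} {q : E} (hgrad : fderiv ℝ r q ≠ 0) :
    ∃ Y, complexGradient r q Y ≠ 0 := by
  by_contra! h
  exact hgrad (ContinuousLinearMap.ext fun v => (complexGradient_apply_eq_zero_iff.1 (h v)).1)

/-- Negativity of the Levi form in some complex tangent direction is an open condition. -/
theorem LeviNegativeAlong.eventually {r : E → ℝ} {q X : E} (hX : LeviNegativeAlong r q X)
    (hr : ContDiffAt ℝ 2 r q) (hgrad : fderiv ℝ r q ≠ 0) :
    ∀ᶠ z in 𝓝 q, ∃ X', LeviNegativeAlong r z X' := by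
  obtain ⟨Y, hY⟩ := exists_complexGradient_apply_ne_zero hgrad
  have hX0 : complexGradient r q X = 0 := complexGradient_apply_eq_zero_iff.2 ⟨hX.1, hX.2.1⟩
  have hd : ContinuousAt (fderiv ℝ r) q :=
    (hr.fderiv_right (m := 1) (by norm_num)).continuousAt
  have hH : ContinuousAt (fderiv ℝ (fderiv ℝ r)) q :=
    ((hr.fderiv_right (m := 1) (by norm_num)).fderiv_right (m := 0) (by norm_num)).continuousAt
  have hlam : ∀ v, ContinuousAt (fun z => complexGradient r z v) q := by
    intro v
    change ContinuousAt (fun z => (fderiv ℝ r z v : ℂ) -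
      Complex.I * (fderiv ℝ r z (Complex.I • v) : ℂ)) q
    fun_prop
  -- The projection of `X` to the complex tangent space at `z`, along `Y`.
  let X' : E → E := fun z => X - (complexGradient r z X / complexGradient r z Y) • Y
  have hX'q : X' q = X := by simp [X', hX0]
  have hX'c : ContinuousAt X' q :=
    continuousAt_const.sub (((hlam X).div (hlam Y) hY).smul continuousAt_const)
  have hneg : ∀ᶠ z in 𝓝 q, fderiv ℝ (fderiv ℝ r) z (X' z) (X' z) +
      fderiv ℝ (fderiv ℝ r) z (Complex.I • X' z) (Complex.I • X' z) < 0 := by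
    have hc : ContinuousAt (fun z => fderiv ℝ (fderiv ℝ r) z (X' z) (X' z) +
      fderiv ℝ (fderiv ℝ r) z (Complex.I • X' z) (Complex.I • X' z)) q :=
      ((hH.clm_apply hX'c).clm_apply hX'c).add
        ((hH.clm_apply (hX'c.const_smul _)).clm_apply (hX'c.const_smul _))
    exact hc.eventually_lt_const (by simpa [hX'q] using hX.2.2)
  filter_upwards [hneg, (hlam Y).eventually_ne hY] with z hz hzY
  have h0 : complexGradient r z (X' z) = 0 := by
    rw [map_sub, map_smul, smul_eq_mul, div_mul_cancel₀ _ hzY, sub_self]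
  obtain ⟨h1, h2⟩ := complexGradient_apply_eq_zero_iff.1 h0
  exact ⟨X' z, h1, h2, hz⟩

/-- Pullback of the second order expansion of `r` to a curve with two given derivatives. -/
theorem ContDiffAt.isLittleO_taylor_two_comp_curve {r : E → ℝ} {q : E} (hr : ContDiffAt ℝ 2 r q)
    {z : ℂ → E} {X Y : E}
    (hz : (fun τ => z τ - (q + τ • X + τ ^ 2 • Y)) =o[𝓝 0] fun τ => ‖τ‖ ^ 2) :
    (fun τ => r (z τ) - (r q + fderiv ℝ r q (τ • X) + fderiv ℝ r q (τ ^ 2 • Y) +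
      1 / 2 * fderiv ℝ (fderiv ℝ r) q (τ • X) (τ • X))) =o[𝓝 0] fun τ => ‖τ‖ ^ 2 := by
  set H := fderiv ℝ (fderiv ℝ r) q
  have h2 : (fun τ : ℂ => ‖τ‖ ^ 2) =o[𝓝 0] fun τ => ‖τ‖ := by
    exact (isLittleO_pow_id (𝕜 := ℝ) one_lt_two).comp_tendsto (tendsto_norm_zero (E := ℂ))
  have hsq : (fun τ : ℂ => τ ^ 2 • Y) =O[𝓝 0] fun τ : ℂ => ‖τ‖ ^ 2 :=
    IsBigO.of_bound ‖Y‖ (Eventually.of_forall fun τ => by simp [norm_smul, mul_comm])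
  have hX : (fun τ : ℂ => τ • X) =O[𝓝 0] fun τ : ℂ => ‖τ‖ :=
    IsBigO.of_bound ‖X‖ (Eventually.of_forall fun τ => by simp [norm_smul, mul_comm])
  have hd : (fun τ => z τ - q - τ • X) =O[𝓝 0] fun τ => ‖τ‖ ^ 2 :=
    (hz.isBigO.add hsq).congr_left fun τ => by abel
  have hzq : (fun τ => z τ - q) =O[𝓝 0] fun τ => ‖τ‖ :=
    ((hd.trans_isLittleO h2).isBigO.add hX).congr_left fun τ => by abel
  have ht : Tendsto (fun τ => z τ - q) (𝓝 0) (𝓝 0) :=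
    hzq.trans_tendsto (tendsto_norm_zero (E := ℂ))
  have h3 : (fun τ => r (q + (z τ - q)) - r q - fderiv ℝ r q (z τ - q) -
      1 / 2 * H (z τ - q) (z τ - q)) =o[𝓝 0] fun τ => ‖τ‖ ^ 2 :=
    (hr.isLittleO_taylor_two.comp_tendsto ht).trans_isBigO (hzq.norm_left.pow 2)
  have h4 : (fun τ => fderiv ℝ r q (z τ - (q + τ • X + τ ^ 2 • Y))) =o[𝓝 0] fun τ => ‖τ‖ ^ 2 :=
    ((fderiv ℝ r q).isBigO_comp _ _).trans_isLittleO hz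
  have hbil : ∀ {f g : ℂ → E} , f =O[𝓝 0] (fun τ => ‖τ‖ ^ 2) → g =O[𝓝 0] (fun τ => ‖τ‖) →
      (fun τ => H (f τ) (g τ)) =o[𝓝 0] fun τ => ‖τ‖ ^ 2 := by
    intro f g hf hg
    have h5 : (fun τ => H (f τ) (g τ)) =O[𝓝 0] fun τ => ‖f τ‖ * ‖g τ‖ :=
      IsBigO.of_bound ‖H‖ (Eventually.of_forall fun τ => by
        simpa [mul_assoc] using H.le_opNorm₂ (f τ) (g τ))
    have h6 := ((hf.trans_isLittleO h2).norm_left.mul_isBigO hg.norm_left)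
    exact (h5.trans_isLittleO h6).congr_right fun τ => by ring
  have hsymm : ∀ v w, H v w = H w v := fun v w =>
    (hr.isSymmSndFDerivAt (by simp)).eq v w
  have h7 := ((h3.add h4).add ((hbil hd hzq).const_mul_left (1 / 2))).add
    ((hbil hd hX).const_mul_left (1 / 2))
  refine h7.congr_left fun τ => ?_
  have e1 : q + (z τ - q) = z τ := by abel
  simp only [e1, map_sub, map_add, sub_apply, hsymm (τ • X)]
  ring

/-- A holomorphic curve that touches the hypersurface `r = 0` at `q` from the side `r < 0`, with
quadratic separation, exhibits a negative direction of the Levi form. -/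
theorem leviNegativeAlong_of_curve {r : E → ℝ} {q : E} (hr : ContDiffAt ℝ 2 r q) (hq : r q = 0)
    {z : ℂ → E} {X Y : E}
    (hz : (fun τ => z τ - (q + τ • X + τ ^ 2 • Y)) =o[𝓝 0] fun τ => ‖τ‖ ^ 2)
    {c : ℝ} (hc : 0 < c) (hrz : ∀ᶠ τ in 𝓝 0, r (z τ) ≤ -c * ‖τ‖ ^ 2) :
    LeviNegativeAlong r q X := by
  set H := fderiv ℝ (fderiv ℝ r) q with hH
  let ψ : ℂ → ℝ := fun τ => fderiv ℝ r q (τ • X) + fderiv ℝ r q (τ ^ 2 • Y) +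
      1 / 2 * H (τ • X) (τ • X)
  have hψ : ∀ᶠ τ in 𝓝 (0 : ℂ), ψ τ ≤ -(c / 2) * ‖τ‖ ^ 2 := by
    filter_upwards [hrz, (hr.isLittleO_taylor_two_comp_curve hz).def (half_pos hc)] with τ h1 h2
    rw [norm_pow, norm_norm, Real.norm_eq_abs] at h2
    have h3 := (abs_le.1 h2).1
    simp only [ψ]
    linarith
  -- Restriction of `ψ` to the real line spanned by `e`.
  have hline : ∀ e : ℂ, ∀ᶠ t : ℝ in 𝓝 0, t * fderiv ℝ r q (e • X) +
      t ^ 2 * (fderiv ℝ r q (e ^ 2 • Y) + 1 / 2 * H (e • X) (e • X)) ≤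
        -(c / 2) * (t ^ 2 * ‖e‖ ^ 2) := by
    intro e
    have h1 : Tendsto (fun t : ℝ => (t : ℂ) * e) (𝓝 0) (𝓝 0) := by
      have : Continuous fun t : ℝ => (t : ℂ) * e := by fun_prop
      simpa using this.tendsto 0
    filter_upwards [h1.eventually hψ] with t ht
    have e1 : ((t : ℂ) * e) • X = t • (e • X) := by rw [mul_smul, Complex.coe_smul]
    have e2 : ((t : ℂ) * e) ^ 2 • Y = (t ^ 2) • (e ^ 2 • Y) := by
      rw [mul_pow, mul_smul, ← Complex.ofReal_pow, Complex.coe_smul]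
    simp only [ψ, e1, e2] at ht
    simp only [map_smul, smul_eq_mul, smul_apply, norm_mul, mul_pow,
      Complex.norm_real, Real.norm_eq_abs, sq_abs] at ht
    linarith
  have hzero : ∀ e : ℂ, fderiv ℝ r q (e • X) = 0 := by
    intro e
    set A := fderiv ℝ r q (e • X)
    set B := fderiv ℝ r q (e ^ 2 • Y) + 1 / 2 * H (e • X) (e • X)
    have hmax : IsLocalMax (fun t : ℝ => t * A + t ^ 2 * B) 0 := by
      filter_upwards [hline e] with t ht
      change t * A + t ^ 2 * B ≤ _ at ht
      have : 0 ≤ c / 2 * (t ^ 2 * ‖e‖ ^ 2) := by positivity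
      simp only [zero_mul, ne_eq, OfNat.ofNat_ne_zero, not_false_eq_true, zero_pow, add_zero]
      linarith
    have hder : HasDerivAt (fun t : ℝ => t * A + t ^ 2 * B) A 0 := by
      exact (((hasDerivAt_id (0 : ℝ)).mul_const A).add
        (((hasDerivAt_id (0 : ℝ)).pow 2).mul_const B)).congr_deriv (by simp)
    exact hmax.hasDerivAt_eq_zero hder
  have hX : fderiv ℝ r q X = 0 := by simpa using hzero 1
  refine ⟨hX, hzero Complex.I, ?_⟩
  -- The terms `t ^ 2 • Y` and `(t * I) ^ 2 • Y` cancel in the sum over the two directions.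
  obtain ⟨t, ⟨h1, h2⟩, ht⟩ := (((hline 1).and (hline Complex.I)).filter_mono
    nhdsWithin_le_nhds |>.and (self_mem_nhdsWithin (s := Ioi (0 : ℝ)))).exists
  simp only [hzero, hX, one_smul, one_pow, Complex.I_sq, neg_smul, map_neg, norm_one,
    Complex.norm_I, mul_zero, zero_add, mul_one] at h1 h2
  have h3 : t ^ 2 * (H X X + H (Complex.I • X) (Complex.I • X)) < 0 := by
    have : 0 < c * t ^ 2 := by have : 0 < t := ht; positivity
    linarith
  exact neg_of_mul_neg_right h3 (by positivity)

/-! ### Levi's theorem -/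

/-- If `δ`, the distance to the complement of `D`, is bounded below near a point `z₀` of a complex
line by a strictly log-subharmonic function that agrees with `δ` at `z₀`, then the Levi form is
negative in some direction at a boundary point `q` nearest to `z₀`: adding to the line a holomorphic
multiple of the vector from `z₀` to `q` gives a curve that touches the boundary from inside. -/
theorem exists_leviNegativeAlong_of_le_infDist {D U : Set E} {r : E → ℝ}
    (hU : IsOpen U) (hr : ContDiffOn ℝ 2 r U) (hDU : D ∩ U = {z | z ∈ U ∧ r z < 0})
    {q z₀ X : E} (hqU : q ∈ U) (hqD : q ∉ D) (hgrad : fderiv ℝ r q ≠ 0)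
    (hq : Metric.infDist z₀ Dᶜ = dist z₀ q) (hpos : 0 < Metric.infDist z₀ Dᶜ)
    {ε : ℝ} (hε : 0 < ε) {g : ℂ → ℂ} (hg : Differentiable ℂ g) (hg0 : g 0 = 0)
    (hδ : ∀ᶠ τ in 𝓝 (0 : ℂ), Metric.infDist z₀ Dᶜ * Real.exp (-(g τ).re + ε * ‖τ‖ ^ 2) ≤
      Metric.infDist (z₀ + τ • X) Dᶜ) :
    r q = 0 ∧ ∃ X', LeviNegativeAlong r q X' := by
  have hrq : ContDiffAt ℝ 2 r q := hr.contDiffAt (hU.mem_nhds hqU)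
  set δ := Metric.infDist z₀ Dᶜ with hδdef
  let k : ℂ → ℂ := fun τ => Complex.exp (-g τ)
  have hk : Differentiable ℂ k := hg.neg.cexp
  have hk0 : k 0 = 1 := by simp [k, hg0]
  let z : ℂ → E := fun τ => z₀ + τ • X + k τ • (q - z₀)
  have hzc : Continuous z := by
    have := hk.continuous
    fun_prop
  have hz0 : z 0 = q := by simp [z, hk0]
  have hzt : Tendsto z (𝓝 0) (𝓝 q) := by simpa [hz0] using hzc.tendsto 0
  have hnorm : ∀ τ, ‖k τ‖ = Real.exp (-(g τ).re) := fun τ => by simp [k, Complex.norm_exp]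
  set c := δ * ε / 2 with hc
  have hcpos : 0 < c := by positivity
  have h1 : ∀ᶠ τ in 𝓝 (0 : ℂ), c * ‖τ‖ ^ 2 ≤ Metric.infDist (z τ) Dᶜ := by
    have hk2 : ∀ᶠ τ in 𝓝 (0 : ℂ), 1 / 2 < ‖k τ‖ := by
      refine hk.continuous.norm.continuousAt.eventually_const_lt ?_
      simp only [hk0]; norm_num
    filter_upwards [hδ, hk2] with τ h2 h3
    have h4 := Metric.infDist_le_infDist_add_dist (x := z₀ + τ • X) (y := z τ) (s := Dᶜ)
    have h5 : dist (z₀ + τ • X) (z τ) = ‖k τ‖ * δ := by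
      rw [hq, dist_eq_norm, dist_eq_norm, ← norm_neg (z₀ - q), neg_sub, ← norm_smul, ← norm_neg]
      simp [z]
    rw [h5] at h4
    rw [Real.exp_add, ← hnorm] at h2
    have h6 := Real.add_one_le_exp (ε * ‖τ‖ ^ 2)
    have h7 : c * ‖τ‖ ^ 2 ≤ δ * (‖k τ‖ * (ε * ‖τ‖ ^ 2)) := by
      rw [hc, show δ * ε / 2 * ‖τ‖ ^ 2 = δ * (1 / 2 * (ε * ‖τ‖ ^ 2)) by ring]
      gcongr
    have h8 : δ * (‖k τ‖ * (ε * ‖τ‖ ^ 2)) ≤ δ * (‖k τ‖ * (Real.exp (ε * ‖τ‖ ^ 2) - 1)) := by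
      gcongr
      linarith
    linarith
  have hmem : ∀ᶠ τ in 𝓝 (0 : ℂ), ∀ w, dist (z τ) w < c * ‖τ‖ ^ 2 → w ∈ D := by
    filter_upwards [h1] with τ h2 w hw
    by_contra hwD
    exact absurd (Metric.infDist_le_dist_of_mem (x := z τ) (show w ∈ Dᶜ from hwD)) (by linarith)
  have hDr : ∀ w ∈ U, w ∈ D → r w < 0 := fun w hwU hwD =>
    (hDU.subset ⟨hwD, hwU⟩ : w ∈ U ∧ r w < 0).2
  have hrq0 : r q = 0 := by
    refine le_antisymm ?_ (not_lt.1 fun hlt =>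
      hqD (hDU.superset (show q ∈ U ∧ r q < 0 from ⟨hqU, hlt⟩)).1)
    have h2 : Tendsto (fun τ => r (z τ)) (𝓝[≠] 0) (𝓝 (r q)) :=
      (hrq.continuousAt.tendsto.comp hzt).mono_left nhdsWithin_le_nhds
    refine le_of_tendsto h2 ?_
    filter_upwards [nhdsWithin_le_nhds hmem, nhdsWithin_le_nhds (hzt.eventually (hU.mem_nhds hqU)),
      self_mem_nhdsWithin] with τ h3 h4 h5
    refine (hDr _ h4 (h3 _ ?_)).le
    rw [dist_self]
    have : 0 < ‖τ‖ := norm_pos_iff.2 h5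
    positivity
  obtain ⟨v, hv⟩ : ∃ v, 0 < fderiv ℝ r q v := by
    obtain ⟨v, hv⟩ : ∃ v, fderiv ℝ r q v ≠ 0 := by
      by_contra! hcon
      exact hgrad (ContinuousLinearMap.ext hcon)
    rcases hv.lt_or_gt with h | h
    · exact ⟨-v, by simpa using h⟩
    · exact ⟨v, h⟩
  have hv0 : 0 < ‖v‖ := norm_pos_iff.2 fun h => by simp [h] at hv
  obtain ⟨a, b, hab⟩ := hk.exists_isLittleO_quadratic
  -- The inscribed ball about `z τ` of radius `c ‖τ‖ ^ 2` forces `r (z τ)` to be quite negative.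
  have hrz : ∀ᶠ τ in 𝓝 0, r (z τ) ≤ -(fderiv ℝ r q v / 2 * (c / (2 * ‖v‖))) * ‖τ‖ ^ 2 := by
    let s : ℂ → ℝ := fun τ => c / (2 * ‖v‖) * ‖τ‖ ^ 2
    have hst : Tendsto (fun τ => (z τ, s τ)) (𝓝 0) (𝓝 (q, 0)) := by
      have : Continuous fun τ => (z τ, s τ) := by fun_prop
      simpa [hz0, s] using this.tendsto 0
    have hwt : Tendsto (fun τ => z τ + s τ • v) (𝓝 0) (𝓝 q) := by
      have : Continuous fun τ => z τ + s τ • v := by fun_prop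
      simpa [hz0, s] using this.tendsto 0
    filter_upwards [hmem, hwt.eventually (hU.mem_nhds hqU), hst.eventually
      ((hrq.hasStrictFDerivAt (by norm_num)).eventually_add_mul_le (half_lt_self hv))]
      with τ h3 h4 h5
    rcases eq_or_ne τ 0 with rfl | hτ
    · simp [hz0, hrq0]
    have hτ' : 0 < ‖τ‖ := norm_pos_iff.2 hτ
    have h6 := h5 (by positivity)
    have h7 := hDr _ h4 (h3 _ ?_)
    · dsimp only [s] at h6 h7
      linarith
    · have h8 : 0 ≤ s τ := by positivity
      rw [dist_self_add_right, norm_smul, Real.norm_of_nonneg h8]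
      dsimp only [s]
      rw [show c / (2 * ‖v‖) * ‖τ‖ ^ 2 * ‖v‖ = c * ‖τ‖ ^ 2 / 2 by field_simp]
      exact half_lt_self (by positivity)
  refine ⟨hrq0, _, leviNegativeAlong_of_curve hrq hrq0 (X := X + a • (q - z₀))
    (Y := b • (q - z₀)) (c := fderiv ℝ r q v / 2 * (c / (2 * ‖v‖))) ?_ (by positivity) hrz⟩
  have h9 : (fun τ => (k τ - (k 0 + a * τ + b * τ ^ 2)) • (q - z₀)) =o[𝓝 0]
      fun τ : ℂ => ‖τ‖ ^ 2 := by
    refine IsBigO.trans_isLittleO (IsBigO.of_bound ‖q - z₀‖ (Eventually.of_forall fun τ => ?_)) hab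
    rw [norm_smul, mul_comm]
  refine h9.congr_left fun τ => ?_
  simp only [z, hk0, sub_smul, add_smul, smul_add, smul_smul, one_smul, mul_comm τ,
    mul_comm (τ ^ 2)]
  abel

theorem norm_le_circleAverage_norm [CompleteSpace E] (z X : E) :
    ‖z‖ ≤ Real.circleAverage (fun ζ : ℂ => ‖z + ζ • X‖) 0 1 := by
  have hd : Differentiable ℂ fun ζ : ℂ => z + ζ • X := by fun_prop
  have h1 : Real.circleAverage (fun ζ : ℂ => z + ζ • X) 0 1 = z := by
    rw [hd.diffContOnCl.circleAverage]; simp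
  nth_rw 1 [← h1]
  rw [Real.circleAverage_def, Real.circleAverage_def, norm_smul, smul_eq_mul,
    Real.norm_of_nonneg (by positivity)]
  gcongr
  exact intervalIntegral.norm_integral_le_integral_norm Real.two_pi_pos.le

theorem circleIntegrable_comp_disc {u : E → ℝ} {A : Set E} (hu : ContinuousOn u A) {z X : E}
    (hz : ∀ ζ : ℂ, ‖ζ‖ ≤ 1 → z + ζ • X ∈ A) :
    CircleIntegrable (fun ζ : ℂ => u (z + ζ • X)) 0 1 := by
  refine ContinuousOn.circleIntegrable zero_le_one (hu.comp (by fun_prop) fun ζ hζ => hz ζ ?_)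
  exact (mem_sphere_zero_iff_norm.1 hζ).le

theorem ContPlurisubharmonicOn.sup {u v : E → ℝ} {A : Set E} (hu : ContPlurisubharmonicOn u A)
    (hv : ContPlurisubharmonicOn v A) : ContPlurisubharmonicOn (fun z => max (u z) (v z)) A := by
  refine ⟨ContinuousOn.sup hu.1 hv.1, fun z X hz => max_le ?_ ?_⟩
  · exact (hu.2 z X hz).trans (Real.circleAverage_mono (circleIntegrable_comp_disc hu.1 hz)
      (circleIntegrable_comp_disc (ContinuousOn.sup hu.1 hv.1) hz) fun _ _ => le_max_left _ _)
  · exact (hv.2 z X hz).trans (Real.circleAverage_mono (circleIntegrable_comp_disc hv.1 hz)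
      (circleIntegrable_comp_disc (ContinuousOn.sup hu.1 hv.1) hz) fun _ _ => le_max_right _ _)

theorem contPlurisubharmonicOn_inv_sub_dist [CompleteSpace E] (p : E) (ε : ℝ) :
    ContPlurisubharmonicOn (fun z => (ε - dist z p)⁻¹) (Metric.ball p ε) := by
  have hc : ContinuousOn (fun z => (ε - dist z p)⁻¹) (Metric.ball p ε) :=
    ContinuousOn.inv₀ (by fun_prop) fun z hz => (sub_pos.2 hz).ne'
  refine ⟨hc, fun z X hz => ?_⟩
  have hz0 : 0 < ε - dist z p := sub_pos.2 (by simpa using hz 0 (by simp))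
  set s := ε - dist z p with hs
  -- Tangent line of the convex function `t ↦ (ε - t)⁻¹` at `dist z p`.
  let ℓ : E → ℝ := fun w => s⁻¹ + (s⁻¹) ^ 2 * (‖w - p‖ - ‖z - p‖)
  have hℓ : ∀ w ∈ Metric.ball p ε, ℓ w ≤ (ε - dist w p)⁻¹ := by
    intro w hw
    have hw0 : 0 < ε - dist w p := sub_pos.2 hw
    have e1 : ‖w - p‖ - ‖z - p‖ = s - (ε - dist w p) := by
      rw [hs, dist_eq_norm, dist_eq_norm]; ring
    simp only [ℓ, e1]
    generalize ε - dist w p = t at hw0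
    have h1 : t⁻¹ - (s⁻¹ + s⁻¹ ^ 2 * (s - t)) = t * (t⁻¹ - s⁻¹) ^ 2 := by
      field_simp
      ring
    have : 0 ≤ t * (t⁻¹ - s⁻¹) ^ 2 := by positivity
    linarith
  have hcont : Continuous ℓ := by fun_prop
  have h2 : s⁻¹ ≤ Real.circleAverage (fun ζ : ℂ => ℓ (z + ζ • X)) 0 1 := by
    have h3 := norm_le_circleAverage_norm (z - p) X
    have hi : CircleIntegrable (fun ζ : ℂ => ‖z - p + ζ • X‖) 0 1 :=
      ContinuousOn.circleIntegrable' (by fun_prop)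
    have h4 : (fun ζ : ℂ => ℓ (z + ζ • X)) = fun ζ : ℂ => (s⁻¹ - (s⁻¹) ^ 2 * ‖z - p‖) +
        (s⁻¹) ^ 2 • ‖z - p + ζ • X‖ := by
      ext ζ
      simp only [ℓ, smul_eq_mul, show z + ζ • X - p = z - p + ζ • X by abel]
      ring
    rw [h4, Real.circleAverage_fun_add (circleIntegrable_const _ _ _) hi.const_fun_smul,
      Real.circleAverage_const, Real.circleAverage_fun_smul, smul_eq_mul]
    have := mul_le_mul_of_nonneg_left h3 (sq_nonneg s⁻¹)
    linarith
  refine h2.trans (Real.circleAverage_mono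
    (circleIntegrable_comp_disc (A := Metric.ball p ε) hcont.continuousOn hz)
    (circleIntegrable_comp_disc hc hz) fun ζ hζ => hℓ _ (hz ζ ?_))
  rw [abs_one] at hζ
  exact (mem_sphere_zero_iff_norm.1 hζ).le

/-- If the Levi form is nowhere negative on the boundary near `p`, then minus the logarithm of the
distance to the complement is plurisubharmonic near `p`. -/
theorem contPlurisubharmonicOn_neg_log_infDist [ProperSpace E] {D U : Set E} {r : E → ℝ} {p : E}
    {ε : ℝ} (hD : IsOpen D) (hU : IsOpen U) (hεU : Metric.ball p (2 * ε) ⊆ U) (hp : p ∉ D)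
    (hr : ContDiffOn ℝ 2 r U) (hgrad : ∀ z ∈ U, fderiv ℝ r z ≠ 0)
    (hDU : D ∩ U = {z | z ∈ U ∧ r z < 0})
    (hlevi : ∀ q ∈ U, r q = 0 → ∀ X, ¬ LeviNegativeAlong r q X) :
    ContPlurisubharmonicOn (fun z => -Real.log (Metric.infDist z Dᶜ)) (D ∩ Metric.ball p ε) := by
  have hne : (Dᶜ).Nonempty := ⟨p, hp⟩
  have hpos : ∀ z ∈ D, 0 < Metric.infDist z Dᶜ := fun z hz =>
    (hD.isClosed_compl.notMem_iff_infDist_pos hne).1 (by simpa using hz)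
  have hc : ContinuousOn (fun z => -Real.log (Metric.infDist z Dᶜ)) (D ∩ Metric.ball p ε) :=
    (ContinuousOn.log (Metric.continuous_infDist_pt _).continuousOn
      fun z hz => (hpos z hz.1).ne').neg
  refine ⟨hc, fun z X hz => ?_⟩
  by_contra! hlt
  obtain ⟨ζ₀, hζ₀, η, hη, g, hg, hg0, htouch⟩ := exists_touching_of_circleAverage_lt
    (v := fun ζ => -Real.log (Metric.infDist (z + ζ • X) Dᶜ))
    (hc.comp (f := fun ζ : ℂ => z + ζ • X) (by fun_prop) fun ζ hζ =>
      hz ζ (mem_closedBall_zero_iff.1 hζ))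
    (by simpa using hlt)
  set z₀ := z + ζ₀ • X with hz₀
  have hz₀m : z₀ ∈ D ∩ Metric.ball p ε := hz ζ₀ (mem_ball_zero_iff.1 hζ₀).le
  obtain ⟨q, hqD, hq⟩ := hD.isClosed_compl.exists_infDist_eq_dist hne z₀
  have hqU : q ∈ U := by
    apply hεU
    have h1 : dist z₀ q ≤ dist z₀ p := hq ▸ Metric.infDist_le_dist_of_mem hp
    have h2 : dist z₀ p < ε := hz₀m.2
    have h3 := dist_triangle_left q p z₀
    rw [Metric.mem_ball]
    linarith
  have hev : ∀ᶠ τ in 𝓝 (0 : ℂ), ζ₀ + τ ∈ Metric.closedBall (0 : ℂ) 1 := by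
    have ht : Tendsto (fun τ => ζ₀ + τ) (𝓝 0) (𝓝 ζ₀) := by
      simpa using (continuous_const_add ζ₀).tendsto 0
    exact ht.eventually (Filter.mem_of_superset (Metric.isOpen_ball.mem_nhds hζ₀)
      Metric.ball_subset_closedBall)
  suffices hδ : ∀ᶠ τ in 𝓝 (0 : ℂ), Metric.infDist z₀ Dᶜ * Real.exp (-(g τ).re + η * ‖τ‖ ^ 2) ≤
      Metric.infDist (z₀ + τ • X) Dᶜ by
    obtain ⟨h1, X', hX'⟩ := exists_leviNegativeAlong_of_le_infDist hU hr hDU hqU hqD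
      (hgrad q hqU) hq (hpos _ hz₀m.1) hη hg hg0 hδ
    exact hlevi q hqU h1 X' hX'
  filter_upwards [hev] with τ hτ
  have h2 := htouch τ hτ
  have e1 : z + (ζ₀ + τ) • X = z₀ + τ • X := by rw [hz₀, add_smul, add_assoc]
  rw [e1] at h2
  have h3 : 0 < Metric.infDist (z₀ + τ • X) Dᶜ :=
    hpos _ (e1 ▸ (hz _ (mem_closedBall_zero_iff.1 hτ)).1)
  rw [← Real.exp_log h3, ← Real.exp_log (hpos _ hz₀m.1), ← Real.exp_add, Real.exp_le_exp]
  linarith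

/-- Levi's theorem, local form: if the Levi form is nowhere negative on the boundary near `p`, then
small balls about `p` have pseudoconvex intersection with `D`. -/
theorem exists_isPseudoconvex_inter_ball [ProperSpace E] {D U : Set E} {r : E → ℝ} {p : E}
    (hD : IsOpen D) (hU : IsOpen U) (hpU : p ∈ U) (hp : p ∉ D)
    (hr : ContDiffOn ℝ 2 r U) (hgrad : ∀ z ∈ U, fderiv ℝ r z ≠ 0)
    (hDU : D ∩ U = {z | z ∈ U ∧ r z < 0})
    (hlevi : ∀ q ∈ U, r q = 0 → ∀ X, ¬ LeviNegativeAlong r q X) :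
    ∃ ε > 0, IsPseudoconvex (D ∩ Metric.ball p ε) := by
  obtain ⟨ρ, hρ, hρU⟩ := Metric.isOpen_iff.1 hU p hpU
  refine ⟨ρ / 2, half_pos hρ, _, (contPlurisubharmonicOn_neg_log_infDist hD hU
    (by rwa [mul_div_cancel₀ _ two_ne_zero]) hp hr hgrad hDU hlevi).sup
      ⟨(contPlurisubharmonicOn_inv_sub_dist p (ρ / 2)).1.mono inter_subset_right, fun z X hz =>
        (contPlurisubharmonicOn_inv_sub_dist p (ρ / 2)).2 z X fun ζ hζ => (hz ζ hζ).2⟩,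
      fun c => ?_⟩
  set ε := ρ / 2
  have hne : (Dᶜ).Nonempty := ⟨p, hp⟩
  have hpos : ∀ z ∈ D, 0 < Metric.infDist z Dᶜ := fun z hz =>
    (hD.isClosed_compl.notMem_iff_infDist_pos hne).1 (by simpa using hz)
  rcases le_or_gt c 0 with hc | hc
  · convert isCompact_empty
    refine eq_empty_of_forall_notMem fun z hz => ?_
    have h1 : 0 < ε - dist z p := sub_pos.2 hz.1.2
    have h2 : (ε - dist z p)⁻¹ ≤ c := (le_max_right _ _).trans hz.2
    have := inv_pos.2 h1
    linarith
  · have heq : {z | z ∈ D ∩ Metric.ball p ε ∧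
        max (-Real.log (Metric.infDist z Dᶜ)) (ε - dist z p)⁻¹ ≤ c} =
        Metric.closedBall p (ε - c⁻¹) ∩ {z | Real.exp (-c) ≤ Metric.infDist z Dᶜ} := by
      ext z
      constructor
      · rintro ⟨⟨hzD, hzB⟩, hz⟩
        have h1 : 0 < ε - dist z p := sub_pos.2 hzB
        have h2 := inv_le_of_inv_le₀ h1 ((le_max_right _ _).trans hz)
        refine ⟨by rw [Metric.mem_closedBall]; linarith, ?_⟩
        have h3 := (le_max_left _ _).trans hz
        exact (Real.le_log_iff_exp_le (hpos z hzD)).1 (by linarith)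
      · rintro ⟨hz1, hz2⟩
        have hz2' : Real.exp (-c) ≤ Metric.infDist z Dᶜ := hz2
        have h0 : 0 < Metric.infDist z Dᶜ := (Real.exp_pos _).trans_le hz2
        rw [Metric.mem_closedBall] at hz1
        have hc' := inv_pos.2 hc
        refine ⟨⟨?_, by rw [Metric.mem_ball]; linarith⟩, max_le ?_ ?_⟩
        · by_contra hzD
          exact h0.ne' (Metric.infDist_zero_of_mem hzD)
        · have := (Real.le_log_iff_exp_le h0).2 hz2'
          linarith
        · exact inv_le_of_inv_le₀ hc (by linarith)
    rw [heq]
    exact (isCompact_closedBall _ _).inter_right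
      (isClosed_le continuous_const (Metric.continuous_infDist_pt _))

/-- Contrapositive form of Levi's theorem. -/
theorem exists_leviNegativeAlong_of_nonPseudoconvexNear [ProperSpace E] {D U : Set E} {r : E → ℝ}
    {p : E} (hD : IsOpen D) (hU : IsOpen U) (hpU : p ∈ U) (hp : p ∉ D)
    (hr : ContDiffOn ℝ 2 r U) (hgrad : ∀ z ∈ U, fderiv ℝ r z ≠ 0)
    (hDU : D ∩ U = {z | z ∈ U ∧ r z < 0}) (hnp : NonPseudoconvexNear D p) :
    ∃ q ∈ U, r q = 0 ∧ ∃ X, LeviNegativeAlong r q X := by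
  by_contra! h
  obtain ⟨ε, hε, hpsc⟩ := exists_isPseudoconvex_inter_ball hD hU hpU hp hr hgrad hDU h
  exact hnp _ Metric.isOpen_ball (Metric.mem_ball_self hε) hpsc

/-! ### Discs tangent to a boundary with a negative Levi form -/

/-- Maximum principle for plurisubharmonic functions on discs of the form
`ζ ↦ q + ζ X + b ζ² Y`. It is derived from the sub-mean value inequality on affine discs only: the
maximum of `u + ε |ζ|² - K |s|²` over a neighbourhood of the disc, where `s` is the offset from the
disc in the direction `Y`, cannot be attained in the interior, because the penalised term increases
in the mean along the affine line tangent to the translated disc through such a point. -/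
theorem ContPlurisubharmonicOn.le_of_le_on_boundary_of_parabola {u : E → ℝ} {A : Set E}
    (hu : ContPlurisubharmonicOn u A) {q X Y : E} {b : ℂ} {ρ δ M : ℝ} (hρ : 0 < ρ) (hδ : 0 < δ)
    (hA : ∀ ζ s : ℂ, ‖ζ‖ ≤ ρ → ‖s‖ ≤ δ → q + ζ • X + (b * ζ ^ 2 + s) • Y ∈ A)
    (hM : ∀ ζ s : ℂ, ‖ζ‖ = ρ → ‖s‖ ≤ δ → u (q + ζ • X + (b * ζ ^ 2 + s) • Y) ≤ M) :
    u q ≤ M := by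
  by_contra! hlt
  let Φ : ℂ × ℂ → E := fun p => q + p.1 • X + (b * p.1 ^ 2 + p.2) • Y
  have hΦ : Continuous Φ := by fun_prop
  set K₀ : Set (ℂ × ℂ) := Metric.closedBall 0 ρ ×ˢ Metric.closedBall 0 δ with hK₀
  have hmem : ∀ p : ℂ × ℂ, p ∈ K₀ ↔ ‖p.1‖ ≤ ρ ∧ ‖p.2‖ ≤ δ := fun p => by simp [hK₀]
  have hcpt : IsCompact K₀ := (isCompact_closedBall _ _).prod (isCompact_closedBall _ _)
  have hcont : ContinuousOn (fun p => u (Φ p)) K₀ := hu.1.comp hΦ.continuousOn fun p hp =>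
    hA _ _ ((hmem p).1 hp).1 ((hmem p).1 hp).2
  obtain ⟨B, hB⟩ := hcpt.bddAbove_image hcont
  have hB' : ∀ p ∈ K₀, u (Φ p) ≤ B := fun p hp => hB (mem_image_of_mem _ hp)
  -- `ε` is so small and `K` so large that the maximum is not attained on the boundary of `K₀`.
  obtain ⟨ε, hε, hερ⟩ : ∃ ε > 0, M + ε * ρ ^ 2 < u q := by
    refine ⟨(u q - M) / (2 * ρ ^ 2), by have := sub_pos.2 hlt; positivity, ?_⟩
    rw [show (u q - M) / (2 * ρ ^ 2) * ρ ^ 2 = (u q - M) / 2 by field_simp]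
    linarith
  obtain ⟨K, hK, hKδ⟩ : ∃ K > 0, B + ε * ρ ^ 2 - K * δ ^ 2 < u q := by
    refine ⟨(|B + ε * ρ ^ 2 - u q| + 1) / δ ^ 2, by positivity, ?_⟩
    rw [div_mul_cancel₀ _ (by positivity)]
    linarith [le_abs_self (B + ε * ρ ^ 2 - u q)]
  obtain ⟨⟨ζ₀, s₀⟩, hp₀, hmax⟩ := hcpt.exists_isMaxOn ⟨0, by simp [hmem, hρ.le, hδ.le]⟩
    (f := fun p => u (Φ p) + ε * ‖p.1‖ ^ 2 - K * ‖p.2‖ ^ 2)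
    ((hcont.add (by fun_prop)).sub (by fun_prop))
  have hmax' : ∀ ζ s : ℂ, ‖ζ‖ ≤ ρ → ‖s‖ ≤ δ → u (Φ (ζ, s)) + ε * ‖ζ‖ ^ 2 - K * ‖s‖ ^ 2 ≤
      u (Φ (ζ₀, s₀)) + ε * ‖ζ₀‖ ^ 2 - K * ‖s₀‖ ^ 2 :=
    fun ζ s hζ hs => hmax ((hmem (ζ, s)).2 ⟨hζ, hs⟩)
  have h0 : u q ≤ u (Φ (ζ₀, s₀)) + ε * ‖ζ₀‖ ^ 2 - K * ‖s₀‖ ^ 2 := by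
    simpa [Φ] using hmax' 0 0 (by simpa using hρ.le) (by simpa using hδ.le)
  obtain ⟨hζ₀, hs₀⟩ := (hmem _).1 hp₀
  dsimp only at hζ₀ hs₀
  have hζlt : ‖ζ₀‖ < ρ := by
    refine lt_of_le_of_ne hζ₀ fun h => ?_
    have h1 : u (Φ (ζ₀, s₀)) ≤ M := hM ζ₀ s₀ h hs₀
    have h2 : 0 ≤ K * ‖s₀‖ ^ 2 := by positivity
    rw [h] at h0
    linarith
  have hslt : ‖s₀‖ < δ := by
    refine lt_of_le_of_ne hs₀ fun h => ?_
    have h1 := hB' _ hp₀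
    have h2 : ε * ‖ζ₀‖ ^ 2 ≤ ε * ρ ^ 2 := by gcongr
    rw [h] at h0
    linarith
  obtain ⟨κ, ⟨hκ1, hκ2, hκ3⟩, hκ⟩ : ∃ κ : ℝ, (‖ζ₀‖ + κ < ρ ∧ ‖s₀‖ + ‖b‖ * κ ^ 2 < δ ∧
      K * ‖b‖ ^ 2 * κ ^ 2 < ε) ∧ 0 < κ := by
    have e1 : ∀ᶠ κ : ℝ in 𝓝 0, ‖ζ₀‖ + κ < ρ :=
      (isOpen_lt (by fun_prop) continuous_const).mem_nhds (by simpa using hζlt)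
    have e2 : ∀ᶠ κ : ℝ in 𝓝 0, ‖s₀‖ + ‖b‖ * κ ^ 2 < δ :=
      (isOpen_lt (by fun_prop) continuous_const).mem_nhds (by simpa using hslt)
    have e3 : ∀ᶠ κ : ℝ in 𝓝 0, K * ‖b‖ ^ 2 * κ ^ 2 < ε :=
      (isOpen_lt (by fun_prop) continuous_const).mem_nhds (by simpa using hε)
    exact ((e1.and (e2.and e3)).filter_mono nhdsWithin_le_nhds |>.and
      (self_mem_nhdsWithin (s := Ioi (0 : ℝ)))).exists
  -- The affine disc through `Φ (ζ₀, s₀)` tangent to the parabola, in the coordinates `(ζ, s)`.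
  have hdisc : ∀ ζ : ℂ, Φ (ζ₀, s₀) + ζ • ((κ : ℂ) • (X + (2 * b * ζ₀) • Y)) =
      Φ (ζ₀ + κ * ζ, s₀ - b * κ ^ 2 * ζ ^ 2) := by
    intro ζ
    simp only [Φ]
    module
  have hin : ∀ ζ : ℂ, ‖ζ‖ ≤ 1 → ‖ζ₀ + κ * ζ‖ ≤ ρ ∧ ‖s₀ - b * κ ^ 2 * ζ ^ 2‖ ≤ δ := by
    intro ζ hζ
    constructor
    · refine (norm_add_le _ _).trans (le_trans ?_ hκ1.le)
      rw [norm_mul, Complex.norm_real, Real.norm_of_nonneg hκ.le]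
      gcongr
      exact mul_le_of_le_one_right hκ.le hζ
    · refine (norm_sub_le _ _).trans (le_trans ?_ hκ2.le)
      rw [norm_mul, norm_mul, norm_pow, norm_pow, Complex.norm_real, Real.norm_of_nonneg hκ.le]
      have : ‖b‖ * κ ^ 2 * ‖ζ‖ ^ 2 ≤ ‖b‖ * κ ^ 2 :=
        mul_le_of_le_one_right (by positivity) (pow_le_one₀ (norm_nonneg _) hζ)
      linarith
  have hdiscA : ∀ ζ : ℂ, ‖ζ‖ ≤ 1 → Φ (ζ₀, s₀) + ζ • ((κ : ℂ) • (X + (2 * b * ζ₀) • Y)) ∈ A := by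
    intro ζ hζ
    rw [hdisc]
    exact hA _ _ (hin ζ hζ).1 (hin ζ hζ).2
  let f : ℂ → ℂ := fun ζ => ((u (Φ (ζ₀, s₀)) - ε * κ ^ 2 + K * (‖b‖ ^ 2 * κ ^ 4) : ℝ) : ℂ) -
    ((2 * ε * κ : ℝ) : ℂ) * ((starRingEnd ℂ) ζ₀ * ζ) -
    ((2 * K * κ ^ 2 : ℝ) : ℂ) * ((starRingEnd ℂ) s₀ * (b * ζ ^ 2))
  have hf : Differentiable ℂ f := by fun_prop
  have hle : ∀ ζ ∈ Metric.sphere (0 : ℂ) |1|,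
      u (Φ (ζ₀, s₀) + ζ • ((κ : ℂ) • (X + (2 * b * ζ₀) • Y))) ≤ (f ζ).re := by
    intro ζ hζ
    rw [abs_one, mem_sphere_zero_iff_norm] at hζ
    rw [hdisc]
    have h1 := hmax' _ _ (hin ζ hζ.le).1 (hin ζ hζ.le).2
    have hadd : ∀ x y : ℂ, ‖x + y‖ ^ 2 = ‖x‖ ^ 2 + 2 * ((starRingEnd ℂ) x * y).re + ‖y‖ ^ 2 := by
      intro x y
      simp only [← Complex.normSq_eq_norm_sq, Complex.normSq_apply, Complex.add_re, Complex.add_im,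
        Complex.mul_re, Complex.conj_re, Complex.conj_im]
      ring
    have h2 : ‖ζ₀ + κ * ζ‖ ^ 2 = ‖ζ₀‖ ^ 2 + 2 * κ * ((starRingEnd ℂ) ζ₀ * ζ).re + κ ^ 2 := by
      rw [hadd, norm_mul, hζ, Complex.norm_real, Real.norm_of_nonneg hκ.le, mul_left_comm,
        Complex.re_ofReal_mul]
      ring
    have h3 : ‖s₀ - b * κ ^ 2 * ζ ^ 2‖ ^ 2 = ‖s₀‖ ^ 2 -
        2 * κ ^ 2 * ((starRingEnd ℂ) s₀ * (b * ζ ^ 2)).re + ‖b‖ ^ 2 * κ ^ 4 := by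
      have e1 : s₀ - b * κ ^ 2 * ζ ^ 2 = s₀ + ((-κ ^ 2 : ℝ) : ℂ) * (b * ζ ^ 2) := by
        push_cast; ring
      rw [e1, hadd, mul_left_comm ((starRingEnd ℂ) s₀), Complex.re_ofReal_mul]
      simp only [norm_mul, norm_pow, hζ, Complex.norm_real, Real.norm_eq_abs, one_pow, mul_one,
        mul_pow, sq_abs]
      ring
    rw [h2, h3] at h1
    simp only [f, Complex.sub_re, Complex.ofReal_re, Complex.re_ofReal_mul]
    linarith
  have hsub := hu.2 _ _ hdiscA
  have h4 := hsub.trans (Real.circleAverage_mono (circleIntegrable_comp_disc hu.1 hdiscA)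
    (Complex.continuous_re.comp hf.continuous).continuousOn.circleIntegrable' hle)
  have h5 : Real.circleAverage (fun ζ => (f ζ).re) 0 1 = (f 0).re := hf.circleAverage_re 0 1
  have h6 : (f 0).re = u (Φ (ζ₀, s₀)) - ε * κ ^ 2 + K * (‖b‖ ^ 2 * κ ^ 4) := by
    simp only [f, mul_zero, sub_zero, ne_eq, OfNat.ofNat_ne_zero, not_false_eq_true, zero_pow,
      Complex.ofReal_re]
  have h7 : K * (‖b‖ ^ 2 * κ ^ 4) < ε * κ ^ 2 := by
    have : K * ‖b‖ ^ 2 * κ ^ 2 * κ ^ 2 < ε * κ ^ 2 := by gcongr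
    linarith
  change u (Φ (ζ₀, s₀)) ≤ Real.circleAverage (fun ζ => (f ζ).re) 0 1 at h4
  linarith

/-- At a point where the Levi form of `r` is negative along `X`, a suitable parabola tangent to `X`
and its translates in the inner direction stay in `r < 0`, except for the point itself. The
coefficient `b` removes the holomorphic part of the Hessian, and `η` is normalised so that `η • Y`
is an outer direction. -/
theorem exists_parabola_of_leviNegativeAlong {r : E → ℝ} {q X Y : E} (hr : ContDiffAt ℝ 2 r q)
    (hq : r q = 0) (hX : LeviNegativeAlong r q X) (hY : complexGradient r q Y ≠ 0) :
    ∃ b η : ℂ, ∃ c > 0, ∀ᶠ p : ℂ × ℝ in 𝓝 0, 0 ≤ p.2 →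
      r (q + p.1 • X + (b * p.1 ^ 2 - p.2 * η) • Y) ≤ -c * ‖p.1‖ ^ 2 - p.2 / 2 := by
  set H := fderiv ℝ (fderiv ℝ r) q with hH
  have hsymm : ∀ v w, H v w = H w v := fun v w =>
    (hr.isSymmSndFDerivAt (by simp)).eq v w
  obtain ⟨hX1, hX2, hS⟩ := hX
  set S := H X X + H (Complex.I • X) (Complex.I • X) with hSdef
  set lam := complexGradient r q Y with hlam
  let B : ℂ := ⟨(H X X - H (Complex.I • X) (Complex.I • X)) / 2, -H X (Complex.I • X)⟩
  set b : ℂ := -B / (2 * lam) with hb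
  set η : ℂ := lam⁻¹ with hη
  refine ⟨b, η, -S / 8, by linarith, ?_⟩
  let z : ℂ → E := fun ζ => q + ζ • X + ζ ^ 2 • (b • Y)
  have hzc : Continuous z := by fun_prop
  have htaylor := hr.isLittleO_taylor_two_comp_curve (z := z) (X := X) (Y := b • Y)
    ((isLittleO_zero (fun τ : ℂ => ‖τ‖ ^ 2) (𝓝 0)).congr_left fun τ => by simp [z])
  have hquad : ∀ ζ : ℂ, fderiv ℝ r q (ζ • X) + fderiv ℝ r q (ζ ^ 2 • (b • Y)) +
      1 / 2 * H (ζ • X) (ζ • X) = S / 4 * ‖ζ‖ ^ 2 := by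
    intro ζ
    have e1 : ζ • X = ζ.re • X + ζ.im • (Complex.I • X) := by
      conv_lhs => rw [← Complex.re_add_im ζ]
      rw [add_smul, mul_smul, Complex.coe_smul, Complex.coe_smul]
    have e2 : fderiv ℝ r q (ζ ^ 2 • (b • Y)) = -(ζ ^ 2 * B).re / 2 := by
      rw [← re_complexGradient_apply, map_smul, map_smul, ← hlam, smul_eq_mul, smul_eq_mul, hb,
        show ζ ^ 2 * (-B / (2 * lam) * lam) = ((-1 / 2 : ℝ) : ℂ) * (ζ ^ 2 * B) by
          push_cast; field_simp, Complex.re_ofReal_mul]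
      ring
    rw [e2, e1, ← Complex.normSq_eq_norm_sq, Complex.normSq_apply]
    simp only [map_add, map_smul, add_apply, smul_apply, smul_eq_mul, hX1, hX2,
      hsymm (Complex.I • X) X, B, pow_two, Complex.mul_re, Complex.mul_im, hSdef]
    ring
  have hcurve : ∀ᶠ ζ in 𝓝 (0 : ℂ), r (z ζ) ≤ S / 8 * ‖ζ‖ ^ 2 := by
    filter_upwards [htaylor.def (show 0 < -S / 8 by linarith)] with ζ hζ
    have h1 := hquad ζ
    rw [hq, zero_add, h1, norm_pow, norm_norm, Real.norm_eq_abs] at hζ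
    have := (abs_le.1 hζ).2
    linarith
  have hout : fderiv ℝ r q (η • Y) = 1 := by
    rw [← re_complexGradient_apply, map_smul, ← hlam, smul_eq_mul, hη, inv_mul_cancel₀ hY,
      Complex.one_re]
  have hmono := (hr.hasStrictFDerivAt (by norm_num)).eventually_add_mul_le
    (v := η • Y) (a := 1 / 2) (by rw [hout]; norm_num)
  have ht : Tendsto (fun p : ℂ × ℝ => (z p.1 - p.2 • (η • Y), p.2)) (𝓝 0) (𝓝 (q, 0)) := by
    have : Continuous fun p : ℂ × ℝ => (z p.1 - p.2 • (η • Y), p.2) := by fun_prop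
    simpa [z] using this.tendsto 0
  have hfst : Tendsto (Prod.fst : ℂ × ℝ → ℂ) (𝓝 0) (𝓝 0) := continuous_fst.tendsto 0
  filter_upwards [ht.eventually hmono, hfst.eventually hcurve] with p h1 h2 hp
  have h3 := h1 hp
  rw [sub_add_cancel] at h3
  have e3 : q + p.1 • X + (b * p.1 ^ 2 - p.2 * η) • Y = z p.1 - p.2 • (η • Y) := by
    rw [← Complex.coe_smul]
    simp only [z]
    module
  rw [e3]
  linarith

/-- A set that agrees, inside a complex affine plane through `q` transversal to the boundary, with
an open set whose boundary has a negative Levi form at `q` in a direction of that plane, is not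
pseudoconvex: the exhaustion function would be bounded on discs converging to a disc through `q`,
by its values on their boundaries. -/
theorem not_isPseudoconvex_of_leviNegativeAlong {D U A : Set E} {r : E → ℝ} {q X Y : E}
    (hD : IsOpen D) (hU : IsOpen U) (hDU : D ∩ U = {z | z ∈ U ∧ r z < 0}) (hqU : q ∈ U)
    (hr : ContDiffAt ℝ 2 r q) (hq : r q = 0) (hX : LeviNegativeAlong r q X)
    (hY : complexGradient r q Y ≠ 0) (hAD : A ⊆ D)
    (hA : ∀ α β : ℂ, q + α • X + β • Y ∈ D → q + α • X + β • Y ∈ A) : ¬ IsPseudoconvex A := by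
  rintro ⟨u, hu, hexh⟩
  obtain ⟨b, η, c, hc, hev⟩ := exists_parabola_of_leviNegativeAlong hr hq hX hY
  let Ψ : ℂ × ℂ → E := fun p => q + p.1 • X + p.2 • Y
  have hΨ : Continuous Ψ := by fun_prop
  have hWo : IsOpen (Ψ ⁻¹' D) := hD.preimage hΨ
  have huW : ContinuousOn (fun p => u (Ψ p)) (Ψ ⁻¹' D) :=
    hu.1.comp hΨ.continuousOn fun p hp => hA _ _ hp
  let γ : ℂ × ℝ → ℂ × ℂ := fun p => (p.1, b * p.1 ^ 2 - p.2 * η)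
  have hγ : Continuous γ := by fun_prop
  have hγU : ∀ᶠ p in 𝓝 (0 : ℂ × ℝ), Ψ (γ p) ∈ U := by
    have ht : Tendsto (fun p => Ψ (γ p)) (𝓝 0) (𝓝 q) := by
      have h := (hΨ.comp hγ).tendsto 0
      rwa [show (Ψ ∘ γ) 0 = q by simp [Ψ, γ]] at h
    exact ht.eventually (hU.mem_nhds hqU)
  obtain ⟨ρ, hρ, hb⟩ := (Metric.nhds_basis_closedBall.eventually_iff).1 (hev.and hγU)
  have hin : ∀ ζ : ℂ, ∀ t : ℝ, ‖ζ‖ ≤ ρ → 0 ≤ t → t ≤ ρ → (ζ ≠ 0 ∨ 0 < t) → γ (ζ, t) ∈ Ψ ⁻¹' D := by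
    intro ζ t hζ ht0 ht h
    obtain ⟨h1, h2⟩ := hb (show (ζ, t) ∈ Metric.closedBall (0 : ℂ × ℝ) ρ by
      rw [mem_closedBall_zero_iff, Prod.norm_def]
      exact max_le hζ (by rwa [Real.norm_of_nonneg ht0]))
    have h3 : r (Ψ (γ (ζ, t))) < 0 := by
      refine (h1 ht0).trans_lt ?_
      dsimp only
      rcases h with h | h
      · have : 0 < ‖ζ‖ := norm_pos_iff.2 h
        have : 0 < c * ‖ζ‖ ^ 2 := by positivity
        linarith
      · have : 0 ≤ c * ‖ζ‖ ^ 2 := by positivity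
        linarith
    exact (hDU.superset (show _ ∈ U ∧ _ from ⟨h2, h3⟩)).1
  have hthick : ∀ {K : Set (ℂ × ℝ)}, IsCompact K → MapsTo γ K (Ψ ⁻¹' D) → ∃ δ > 0,
      IsCompact (Metric.cthickening δ (γ '' K)) ∧ Metric.cthickening δ (γ '' K) ⊆ Ψ ⁻¹' D ∧
      ∀ p ∈ K, ∀ s : ℂ, ‖s‖ ≤ δ →
        (p.1, b * p.1 ^ 2 - p.2 * η + s) ∈ Metric.cthickening δ (γ '' K) := by
    intro K hK hKD
    obtain ⟨δ, hδ, hsub⟩ := (hK.image hγ).exists_cthickening_subset_open hWo hKD.image_subset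
    refine ⟨δ, hδ, (hK.image hγ).cthickening, hsub, fun p hp s hs => ?_⟩
    refine Metric.mem_cthickening_of_dist_le _ (γ p) _ _ (mem_image_of_mem _ hp) ?_
    rw [Prod.dist_eq]
    simpa [γ, dist_eq_norm, hδ.le] using hs
  -- A bound for `u` near the boundaries of all the discs, including the limiting one.
  obtain ⟨δ₁, hδ₁, hcpt, hsub₁, hδ₁'⟩ := hthick
    (K := Metric.sphere (0 : ℂ) ρ ×ˢ Icc (0 : ℝ) ρ) ((isCompact_sphere _ _).prod isCompact_Icc)
    (by
      rintro ⟨ζ, t⟩ ⟨hζ, ht0, ht⟩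
      rw [mem_sphere_zero_iff_norm] at hζ
      exact hin ζ t hζ.le ht0 ht (Or.inl (norm_pos_iff.1 (hζ ▸ hρ))))
  obtain ⟨M, hM⟩ := hcpt.bddAbove_image (huW.mono hsub₁)
  have hcenter : ∀ t : ℝ, 0 < t → t ≤ ρ → q - (t * η) • Y ∈ {z | z ∈ A ∧ u z ≤ M} := by
    intro t ht0 ht
    obtain ⟨δ₂, hδ₂, -, hsub₂, hδ₂'⟩ := hthick
      (K := Metric.closedBall (0 : ℂ) ρ ×ˢ {t})
      ((isCompact_closedBall _ _).prod isCompact_singleton)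
      (by
        rintro ⟨ζ, t'⟩ ⟨hζ, rfl⟩
        exact hin ζ _ (mem_closedBall_zero_iff.1 hζ) ht0.le ht (Or.inr ht0))
    have hpt : ∀ ζ s : ℂ, q - (t * η) • Y + ζ • X + (b * ζ ^ 2 + s) • Y =
        Ψ (ζ, b * ζ ^ 2 - t * η + s) := fun ζ s => by simp only [Ψ]; module
    have hA' : ∀ ζ s : ℂ, ‖ζ‖ ≤ ρ → ‖s‖ ≤ min δ₁ δ₂ →
        q - (t * η) • Y + ζ • X + (b * ζ ^ 2 + s) • Y ∈ A := by
      intro ζ s hζ hs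
      rw [hpt]
      exact hA _ _ (hsub₂ (hδ₂' (ζ, t) ⟨mem_closedBall_zero_iff.2 hζ, rfl⟩ s
        (hs.trans (min_le_right _ _))))
    refine ⟨by simpa using hA' 0 0 (by simpa using hρ.le) (by simp [hδ₁.le, hδ₂.le]),
      hu.le_of_le_on_boundary_of_parabola hρ (lt_min hδ₁ hδ₂) hA' fun ζ s hζ hs => ?_⟩
    rw [hpt]
    exact hM (mem_image_of_mem (fun p => u (Ψ p)) (hδ₁' (ζ, t)
      ⟨mem_sphere_zero_iff_norm.2 hζ, ht0.le, ht⟩ s (hs.trans (min_le_left _ _))))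
  have hlim : Tendsto (fun t : ℝ => q - ((t : ℂ) * η) • Y) (𝓝[>] 0) (𝓝 q) := by
    have : Continuous fun t : ℝ => q - ((t : ℂ) * η) • Y := by fun_prop
    simpa using (this.tendsto 0).mono_left nhdsWithin_le_nhds
  have hqA := (hexh M).isClosed.mem_of_tendsto hlim (by
    filter_upwards [Ioc_mem_nhdsGT hρ] with t ht using hcenter t ht.1 ht.2)
  exact (hDU.subset ⟨hAD hqA.1, hqU⟩ : q ∈ U ∧ r q < 0).2.ne hq

/-! ### Exceptional points -/

/-- A real hypersurface is not contained, near any of its points, in its complex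
tangent hyperplane. -/
theorem frequently_complexGradient_sub_ne_zero [CompleteSpace E] {r : E → ℝ} {q : E}
    (hr : ContDiffAt ℝ 2 r q) (hgrad : fderiv ℝ r q ≠ 0) :
    ∃ᶠ z in 𝓝 q, r z = r q ∧ complexGradient r q (z - q) ≠ 0 := by
  intro hcon
  have hrs := hr.hasStrictFDerivAt (by norm_num)
  let L : StrongDual ℝ E :=
    (fderiv ℝ r q).comp ((Complex.I • ContinuousLinearMap.id ℂ E).restrictScalars ℝ)
  have hL : HasStrictFDerivAt (fun z => L (z - q)) L q := by
    have := L.hasStrictFDerivAt.comp q ((hasStrictFDerivAt_id q).sub_const q)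
    exact this.congr_fderiv (by ext; simp)
  have key : ∀ v, fderiv ℝ r q v = 0 → fderiv ℝ r q (Complex.I • v) = 0 := by
    intro v hv
    refine hrs.apply_eq_zero_of_eventually_eq_zero hL hgrad ?_ hv
    filter_upwards [hcon] with z hz hzr
    rw [not_and_not_right] at hz
    exact (complexGradient_apply_eq_zero_iff.1 (hz hzr)).2
  obtain ⟨Y, hY⟩ : ∃ Y, fderiv ℝ r q Y ≠ 0 := by
    by_contra! h
    exact hgrad (ContinuousLinearMap.ext h)
  -- A tangent vector in the complex line of `Y` is mapped out of the tangent space by `I`.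
  set μ := fderiv ℝ r q (Complex.I • Y) / fderiv ℝ r q Y with hμ
  have h1 : fderiv ℝ r q (Complex.I • Y - μ • Y) = 0 := by
    rw [map_sub, map_smul (fderiv ℝ r q) μ, smul_eq_mul, hμ, div_mul_cancel₀ _ hY, sub_self]
  have h2 := key _ h1
  rw [smul_sub, smul_smul, Complex.I_mul_I, smul_comm, map_sub, map_smul (fderiv ℝ r q) μ, neg_smul,
    one_smul, map_neg, smul_eq_mul] at h2
  have h3 : fderiv ℝ r q (Complex.I • Y) = μ * fderiv ℝ r q Y := by
    rw [hμ, div_mul_cancel₀ _ hY]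
  rw [h3] at h2
  have h4 : fderiv ℝ r q Y * (1 + μ ^ 2) = 0 := by linarith
  rcases mul_eq_zero.1 h4 with h5 | h5
  · exact hY h5
  · nlinarith [sq_nonneg μ]

/-- The complex tangent vectors `V` at `z` such that, for each complex tangent vector `v`, the real
Hessian of `r` vanishes at `(v, V)` and `(v, I • V)`. They lie in the kernel of the Levi form. The
two conditions are encoded as the vanishing at `V` of the complex-linear extension of `H(v, ·)`. -/
noncomputable def hessianKernel (r : E → ℝ) (z : E) : Submodule ℂ E :=
  LinearMap.ker (complexGradient r z).toLinearMap ⊓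
    ⨅ v ∈ LinearMap.ker (complexGradient r z).toLinearMap,
      LinearMap.ker (StrongDual.extendRCLike (𝕜 := ℂ) (fderiv ℝ (fderiv ℝ r) z v)).toLinearMap

theorem mem_hessianKernel_iff {r : E → ℝ} {z V : E} :
    V ∈ hessianKernel r z ↔ complexGradient r z V = 0 ∧ ∀ v, complexGradient r z v = 0 →
      fderiv ℝ (fderiv ℝ r) z v V = 0 ∧ fderiv ℝ (fderiv ℝ r) z v (Complex.I • V) = 0 := by
  have h : ∀ v, StrongDual.extendRCLike (𝕜 := ℂ) (fderiv ℝ (fderiv ℝ r) z v) V = 0 ↔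
      fderiv ℝ (fderiv ℝ r) z v V = 0 ∧ fderiv ℝ (fderiv ℝ r) z v (Complex.I • V) = 0 := by
    intro v
    have e1 := StrongDual.re_extendRCLike_apply (𝕜 := ℂ) (fderiv ℝ (fderiv ℝ r) z v) V
    have e2 := StrongDual.im_extendRCLike_apply (𝕜 := ℂ) (fderiv ℝ (fderiv ℝ r) z v) V
    simp only [RCLike.re_to_complex, RCLike.im_to_complex, RCLike.I_to_complex] at e1 e2
    rw [Complex.ext_iff, e1, e2, Complex.zero_re, Complex.zero_im, neg_eq_zero]
  simp only [hessianKernel, Submodule.mem_inf, Submodule.mem_iInf, LinearMap.mem_ker,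
    ContinuousLinearMap.coe_coe, h]

theorem hessianKernel_lt_ker {r : E → ℝ} {z X : E} (hX : LeviNegativeAlong r z X) :
    hessianKernel r z < LinearMap.ker (complexGradient r z).toLinearMap := by
  have hX0 : complexGradient r z X = 0 := complexGradient_apply_eq_zero_iff.2 ⟨hX.1, hX.2.1⟩
  refine lt_of_le_of_ne inf_le_left fun h => ?_
  have hmem : X ∈ hessianKernel r z := h ▸ hX0
  have h1 := (mem_hessianKernel_iff.1 hmem).2 X hX0
  have h2 := (mem_hessianKernel_iff.1 hmem).2 (Complex.I • X) (by rw [map_smul, hX0, smul_zero])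
  have h3 := hX.2.2
  rw [h1.1, h2.2] at h3
  simp at h3

/-- If the complex tangent hyperplanes at the points of a hypersurface near `q` all pass through
`a`, then differentiation of this condition along the hypersurface shows that `a - q` is in the
kernel of the Hessian. -/
theorem sub_mem_hessianKernel [CompleteSpace E] {r : E → ℝ} {q a : E} (hr : ContDiffAt ℝ 2 r q)
    (hgrad : fderiv ℝ r q ≠ 0)
    (h : ∀ᶠ z in 𝓝 q, r z = r q → complexGradient r z (a - z) = 0) :
    a - q ∈ hessianKernel r q := by
  have hrs := hr.hasStrictFDerivAt (by norm_num)
  have hH : HasStrictFDerivAt (fderiv ℝ r) (fderiv ℝ (fderiv ℝ r) q) q :=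
    (hr.fderiv_right (m := 1) (by norm_num)).hasStrictFDerivAt (by norm_num)
  have hsub : HasStrictFDerivAt (fun z => a - z) (-ContinuousLinearMap.id ℝ E) q :=
    (hasStrictFDerivAt_id q).const_sub a
  have hsubI : HasStrictFDerivAt (fun z => Complex.I • (a - z))
      ((Complex.I • ContinuousLinearMap.id ℂ E).restrictScalars ℝ ∘L
        (-ContinuousLinearMap.id ℝ E)) q :=
    ((Complex.I • ContinuousLinearMap.id ℂ E).restrictScalars ℝ).hasStrictFDerivAt.comp q hsub
  refine mem_hessianKernel_iff.2 ⟨h.self_of_nhds rfl, fun v hv => ?_⟩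
  obtain ⟨hv1, hv2⟩ := complexGradient_apply_eq_zero_iff.1 hv
  constructor
  · have h1 := hrs.apply_eq_zero_of_eventually_eq_zero (hH.clm_apply hsub) hgrad
      (h.mono fun z hz hzr => (complexGradient_apply_eq_zero_iff.1 (hz hzr)).1) hv1
    simpa [hv1] using h1
  · have h1 := hrs.apply_eq_zero_of_eventually_eq_zero (hH.clm_apply hsubI) hgrad
      (h.mono fun z hz hzr => (complexGradient_apply_eq_zero_iff.1 (hz hzr)).2) hv1
    simpa [hv2] using h1

/-- An exceptional point lies on the complex tangent hyperplane at each boundary point with a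
negative Levi form: otherwise the plane through the two points that contains the negative direction
is transversal to the boundary there. -/
theorem complexGradient_sub_eq_zero_of_forall_isPseudoconvex {D U : Set E} {r : E → ℝ}
    (hD : IsOpen D) (hU : IsOpen U) (hr : ContDiffOn ℝ 2 r U)
    (hDU : D ∩ U = {z | z ∈ U ∧ r z < 0}) {z a X : E} (hz : z ∈ U) (hz0 : r z = 0)
    (hX : LeviNegativeAlong r z X)
    (ha : ∀ P : AffineSubspace ℂ E, a ∈ P → Module.finrank ℂ P.direction = 2 →
      IsPseudoconvex ((P : Set E) ∩ D)) :
    complexGradient r z (a - z) = 0 := by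
  by_contra hY
  have hX0 : complexGradient r z X = 0 := complexGradient_apply_eq_zero_iff.2 ⟨hX.1, hX.2.1⟩
  have hXne : X ≠ 0 := by
    rintro rfl
    simpa using hX.2.2
  have hli : LinearIndependent ℂ ![X, a - z] := by
    refine (LinearIndependent.pair_iff' hXne).2 fun c hc => hY ?_
    rw [← hc, map_smul, hX0, smul_zero]
  refine not_isPseudoconvex_of_leviNegativeAlong hD hU hDU hz (hr.contDiffAt (hU.mem_nhds hz)) hz0
    hX hY inter_subset_right ?_
    (ha (AffineSubspace.mk' z (Submodule.span ℂ (range ![X, a - z]))) ?_ ?_)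
  · intro α β h
    refine ⟨?_, h⟩
    rw [SetLike.mem_coe, AffineSubspace.mem_mk', vsub_eq_sub,
      show z + α • X + β • (a - z) - z = α • X + β • (a - z) by abel]
    exact Submodule.add_mem _ (Submodule.smul_mem _ _ (Submodule.subset_span ⟨0, rfl⟩))
      (Submodule.smul_mem _ _ (Submodule.subset_span ⟨1, rfl⟩))
  · rw [AffineSubspace.mem_mk', vsub_eq_sub]
    exact Submodule.subset_span ⟨1, rfl⟩
  · rw [AffineSubspace.direction_mk', finrank_span_eq_card hli]
    simp

theorem exists_submodule_ge_finrank_eq {K V : Type*} [DivisionRing K] [AddCommGroup V] [Module K V]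
    [FiniteDimensional K V] (W : Submodule K V) {m : ℕ} (h₁ : Module.finrank K W ≤ m)
    (h₂ : m ≤ Module.finrank K V) : ∃ W' ≥ W, Module.finrank K W' = m := by
  obtain ⟨C, hC⟩ := W.exists_isCompl
  have hsum := Submodule.finrank_add_eq_of_isCompl hC
  obtain ⟨f, hf⟩ := exists_linearIndependent_of_le_finrank
    (R := K) (M := C) (n := m - Module.finrank K W) (by omega)
  let S : Submodule K V := (Submodule.span K (range f)).map C.subtype
  have hS : Module.finrank K S = m - Module.finrank K W := by
    rw [Submodule.finrank_map_subtype_eq, finrank_span_eq_card hf, Fintype.card_fin]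
  have hdisj : Disjoint W S := hC.disjoint.mono_right (Submodule.map_subtype_le _ _)
  refine ⟨W ⊔ S, le_sup_left, ?_⟩
  have := Submodule.finrank_sup_add_finrank_inf_eq W S
  rw [hdisj.eq_bot, finrank_bot] at this
  omega

/-- Near a boundary point `q` with a negative Levi form there is a second such point `q'` outside
the complex tangent hyperplane at `q`. The exceptional points differ by vectors in the intersection
of the Hessian kernel at `q'` with the complex tangent space at `q`, which is strictly contained in
the former and has therefore codimension at least three. -/
theorem exists_submodule_finrank_add_three_le [FiniteDimensional ℂ E] {D U : Set E} {r : E → ℝ}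
    (hD : IsOpen D) (hU : IsOpen U) (hr : ContDiffOn ℝ 2 r U) (hgrad : ∀ z ∈ U, fderiv ℝ r z ≠ 0)
    (hDU : D ∩ U = {z | z ∈ U ∧ r z < 0}) {q X a₀ : E} (hq : q ∈ U) (hq0 : r q = 0)
    (hX : LeviNegativeAlong r q X) {S : Set E}
    (hS : ∀ a ∈ S, ∀ P : AffineSubspace ℂ E, a ∈ P → Module.finrank ℂ P.direction = 2 →
      IsPseudoconvex ((P : Set E) ∩ D)) (ha₀ : a₀ ∈ S) :
    ∃ W : Submodule ℂ E, Module.finrank ℂ W + 3 ≤ Module.finrank ℂ E ∧ ∀ a ∈ S, a - a₀ ∈ W := by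
  have : CompleteSpace E := FiniteDimensional.complete ℂ E
  have hrq := hr.contDiffAt (hU.mem_nhds hq)
  have hgood : ∀ᶠ z in 𝓝 q, z ∈ U ∧ ∃ X', LeviNegativeAlong r z X' :=
    (show ∀ᶠ z in 𝓝 q, z ∈ U from hU.mem_nhds hq).and (hX.eventually hrq (hgrad q hq))
  have hker : ∀ z, z ∈ U → r z = 0 → (∃ X', LeviNegativeAlong r z X') → ∀ a ∈ S,
      a - z ∈ hessianKernel r z := by
    rintro z hz hz0 ⟨X', hX'⟩ a ha
    have hrz := hr.contDiffAt (hU.mem_nhds hz)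
    refine sub_mem_hessianKernel hrz (hgrad z hz) ?_
    filter_upwards [hU.mem_nhds hz, hX'.eventually hrz (hgrad z hz)] with w hw hwX hwr
    obtain ⟨X'', hX''⟩ := hwX
    exact complexGradient_sub_eq_zero_of_forall_isPseudoconvex hD hU hr hDU hw (hwr.trans hz0) hX''
      (hS a ha)
  obtain ⟨q', ⟨hq'r, hq'ne⟩, hq'U, X', hX'⟩ :=
    ((frequently_complexGradient_sub_ne_zero hrq (hgrad q hq)).and_eventually hgood).exists
  have hq'0 : r q' = 0 := hq'r.trans hq0
  have hN := hker q hq hq0 ⟨X, hX⟩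
  have hN' := hker q' hq'U hq'0 ⟨X', hX'⟩
  have htan : ∀ a ∈ S, complexGradient r q (a - q) = 0 := fun a ha =>
    (mem_hessianKernel_iff.1 (hN a ha)).1
  set G := LinearMap.ker (complexGradient r q).toLinearMap with hG
  refine ⟨hessianKernel r q' ⊓ G, ?_, fun a ha => ⟨?_, ?_⟩⟩
  · have h1 : hessianKernel r q' ⊓ G < hessianKernel r q' := by
      refine lt_of_le_of_ne inf_le_left fun h => hq'ne ?_
      have h2 : a₀ - q' ∈ hessianKernel r q' ⊓ G := by
        rw [h]
        exact hN' a₀ ha₀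
      have h3 : complexGradient r q (a₀ - q') = 0 := h2.2
      rw [show q' - q = (a₀ - q) - (a₀ - q') by abel, map_sub, htan a₀ ha₀, h3, sub_zero]
    have h2 := hessianKernel_lt_ker hX'
    have h3 : LinearMap.ker (complexGradient r q').toLinearMap < ⊤ := by
      obtain ⟨Y, hY⟩ := exists_complexGradient_apply_ne_zero (hgrad q' hq'U)
      refine lt_top_iff_ne_top.2 fun h => hY ?_
      have : Y ∈ LinearMap.ker (complexGradient r q').toLinearMap := h ▸ Submodule.mem_top
      exact this
    have h1' := Submodule.finrank_lt_finrank_of_lt h1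
    have h2' := Submodule.finrank_lt_finrank_of_lt h2
    have h3' := Submodule.finrank_lt_finrank_of_lt h3
    rw [finrank_top] at h3'
    omega
  · rw [show a - a₀ = (a - q') - (a₀ - q') by abel]
    exact Submodule.sub_mem _ (hN' a ha) (hN' a₀ ha₀)
  · rw [show a - a₀ = (a - q) - (a₀ - q) by abel]
    exact Submodule.sub_mem _ (htan a ha) (htan a₀ ha₀)

theorem mainTheorem7 (n : ℕ) (hn : 3 ≤ n) (D : Set (EuclideanSpace ℂ (Fin n)))
    (hD : IsOpen D) (hDnp : ¬ IsPseudoconvex D)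
    (hsm : ∃ p ∈ frontier D, IsC2SmoothNear D p ∧ NonPseudoconvexNear D p) :
    ∃ T : AffineSubspace ℂ (EuclideanSpace ℂ (Fin n)),
      (T : Set (EuclideanSpace ℂ (Fin n))).Nonempty ∧
      Module.finrank ℂ T.direction + 3 = n ∧
      (nonPseudoconvexPlanes D)ᶜ ⊆ (T : Set (EuclideanSpace ℂ (Fin n))) := by
  obtain ⟨p, hpD, ⟨U, r, hU, hpU, hr, hgrad, hDU⟩, hnp⟩ := hsm
  have hp : p ∉ D := by
    rw [hD.frontier_eq] at hpD
    exact hpD.2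
  obtain ⟨q, hq, hq0, X, hX⟩ :=
    exists_leviNegativeAlong_of_nonPseudoconvexNear hD hU hpU hp hr hgrad hDU hnp
  obtain ⟨a₀, W, hW, hmem⟩ : ∃ (a₀ : EuclideanSpace ℂ (Fin n))
      (W : Submodule ℂ (EuclideanSpace ℂ (Fin n))), Module.finrank ℂ W + 3 ≤ n ∧
        ∀ a ∈ (nonPseudoconvexPlanes D)ᶜ, a - a₀ ∈ W := by
    rcases (nonPseudoconvexPlanes D)ᶜ.eq_empty_or_nonempty with h | ⟨a₀, ha₀⟩
    · exact ⟨0, ⊥, by simpa using hn, by simp [h]⟩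
    · obtain ⟨W, hW, hmem⟩ := exists_submodule_finrank_add_three_le hD hU hr hgrad hDU hq hq0 hX
        (fun a ha => (mem_compl_nonPseudoconvexPlanes D a).1 ha) ha₀
      exact ⟨a₀, W, by simpa using hW, hmem⟩
  obtain ⟨W', hWW', hW'⟩ := exists_submodule_ge_finrank_eq W (m := n - 3) (by omega)
    (by rw [finrank_euclideanSpace_fin]; omega)
  refine ⟨AffineSubspace.mk' a₀ W', AffineSubspace.mk'_nonempty _ _, ?_, fun a ha => ?_⟩
  · rw [AffineSubspace.direction_mk', hW']
    omega
  · rw [SetLike.mem_coe, AffineSubspace.mem_mk', vsub_eq_sub]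
    exact hWW' (hmem a ha)
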